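/- All graphs are finite and may have parallel edges and loops. In a bidirected graph every end of every edge carries a sign $+$ or $-$. An $(\alpha,\beta)$-ditrail from $x$ to $y$ is a walk from $x$ to $y$ with no repeated edge such that, at each intermediate vertex, the signs of that vertex over the arriving and the leaving edge are distinct, the sign of $x$ over the first edge is $\alpha$, and the sign of $y$ over the last edge is $\beta$; the trivial walk with no edge counts as an $(\alpha,-\alpha)$-ditrail for both signs $\alpha$. An $\alpha$-ditrail is an $(\alpha,\beta)$-ditrail for some $\beta\in\{+,-\}$. Let $G$ be a bidirected graph with a vertex $r$. $G$ is an $\alpha$-semiradial (resp. $\alpha$-radial) with root $r$ if every vertex $v$ has an $\alpha$-ditrail (resp. an $(\alpha,-\alpha)$-ditrail) to $r$. It is an absolute semiradial with root $r$ if it is an $\alpha$-semiradial with root $r$ for both signs $\alpha$. An $\alpha$-semiradial with root $r$ is linear if there is no loop over $r$ and no vertex has a $-\alpha$-ditrail to $r$, except for the trivial one from $r$ to $r$. An $\alpha$-semiradial with root $r$ is sharp if no vertex $v\ne r$ adjacent to $r$ has a $-\alpha$-ditrail to $r$. An $\alpha$-radial with root $r$ is almost strong if every vertex $v\neq r$ has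 a $(-\alpha,-\alpha)$-ditrail to $r$ but there is no $(-\alpha,-\alpha)$-ditrail from $r$ to $r$. The absolute ground of a bidirected graph with root $r$ is its maximum subgraph that is an absolute semiradial with root $r$. Let $G$ and $H$ be disjoint bidirected graphs, $s\in V(G)$, $T\subseteq V(H)$. A gluing sum $(G;s)\oplus(H;T)$ is a bidirected graph obtained from the disjoint union of $G$ and $H$ by deleting $s$ and re-attaching each edge end at $s$ (both ends, independently, for a loop over $s$) to some vertex of $T$, all signs being kept. For $\alpha\in\{+,-\}$, classes $\mathcal{R}_\alpha(r)$ and $\mathcal{L}_\alpha(r)$ of bidirected graphs with vertex $r$ (for all vertices $r$) are defined simultaneously as the smallest classes such that: (i) every almost strong $\alpha$-radial with root $r$ is in $\mathcal{R}_\alpha(r)$; (ii) every linear $\alpha$-semiradial with root $r$ is in $\mathcal{L}_\alpha(r)$; (iii) if $G\in\mathcal{R}_\alpha(r)$, then every bidirected graph obtained from $G$ by adding edges $rv$ with $v\in V(G)$, over which $r$ has the sign $\alpha$, is in $\mathcal{R}_\alpha(r)$; (iv) if $G\in\mathcal{L}_\alpha(s)$ and $H$ is an almost strong $\alpha$-radial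 with root $r$ disjoint from $G$, then every gluing sum $(G;s)\oplus(H;V(H)\setminus\{r\})$ is in $\mathcal{R}_\alpha(r)$; (v) if $G\in\mathcal{R}_\alpha(s)$ and $H$ is a linear $\alpha$-semiradial with root $r$ disjoint from $G$, then every gluing sum $(G;s)\oplus(H;V(H)\setminus\{r\})$ is in $\mathcal{L}_\alpha(r)$. Theorem. Let $\alpha\in\{+,-\}$. A bidirected graph is an $\alpha$-semiradial with root $r$ if and only if it is a gluing sum $(G;s)\oplus(H;V(H))$ for some vertex $s$, some $G\in\mathcal{L}_\alpha(s)$ and some absolute semiradial $H$ with root $r$ disjoint from $G$. In every such gluing sum, $H$ is the absolute ground of the sum. Moreover, a bidirected graph $G$ is in $\mathcal{L}_\alpha(s)$ if and only if $G$ is a sharp $\alpha$-semiradial with root $s$ and there is no loop over $s$. -/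

import Mathlib

/-- A finite bidirected graph (parallel edges and loops are allowed) with vertices taken from `V` and
edges taken from `E`. The two signs are `1` and `-1` in `ℤˣ`. An edge is an unordered pair of ends,
and each end is a vertex together with the sign that this vertex has over the edge; the value of
`ends` outside `edgeSet` is irrelevant. -/
structure BidirectedGraph (V E : Type*) where
  vertexSet : Set V
  edgeSet : Set E
  ends : E → Sym2 (V × ℤˣ)
  finite_vertexSet : vertexSet.Finite
  finite_edgeSet : edgeSet.Finite
  mem_vertexSet : ∀ e ∈ edgeSet, ∀ p ∈ ends e, p.1 ∈ vertexSet

namespace BidirectedGraph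

variable {V E : Type*}

/-- `G.Joins e x a y b`: the edge `e` of `G` joins `x` and `y`, where `x` has the sign `a` and `y`
has the sign `b` over `e`. -/
def Joins (G : BidirectedGraph V E) (e : E) (x : V) (a : ℤˣ) (y : V) (b : ℤˣ) : Prop :=
  e ∈ G.edgeSet ∧ G.ends e = s((x, a), (y, b))

/-- `G.IsDiwalk x a l y b`: `l` is the list of edges of an `(a, b)`-diwalk of `G` from `x` to `y`.
At each intermediate vertex the signs over the arriving and over the leaving edge are distinct; the
first vertex has the sign `a` over the first edge and the last vertex has the sign `b` over the last
edge; the trivial diwalk, which has no edge, is an `(a, -a)`-diwalk for both signs `a`. -/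
inductive IsDiwalk (G : BidirectedGraph V E) : V → ℤˣ → List E → V → ℤˣ → Prop
  | nil (x : V) (a : ℤˣ) (hx : x ∈ G.vertexSet) : IsDiwalk G x a [] x (-a)
  | cons (x : V) (a : ℤˣ) (e : E) (y : V) (b : ℤˣ) (l : List E) (z : V) (c : ℤˣ)
      (h : G.Joins e x a y b) (hl : IsDiwalk G y (-b) l z c) : IsDiwalk G x a (e :: l) z c

/-- A ditrail is a diwalk without repeated edges. -/
def IsDitrail (G : BidirectedGraph V E) (x : V) (a : ℤˣ) (l : List E) (y : V) (b : ℤˣ) : Prop :=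
  G.IsDiwalk x a l y b ∧ l.Nodup

/-- There is an `(a, b)`-ditrail from `x` to `y`. -/
def HasDitrail (G : BidirectedGraph V E) (x : V) (a : ℤˣ) (y : V) (b : ℤˣ) : Prop :=
  ∃ l, G.IsDitrail x a l y b

/-- There is an `a`-ditrail from `x` to `y`. -/
def HasDitrailFrom (G : BidirectedGraph V E) (x : V) (a : ℤˣ) (y : V) : Prop :=
  ∃ b, G.HasDitrail x a y b

/-- There is a loop over `x`. -/
def HasLoop (G : BidirectedGraph V E) (x : V) : Prop := ∃ e a b, G.Joins e x a x b

/-- `G` is an `α`-radial with root `r`. -/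
def IsRadial (G : BidirectedGraph V E) (α : ℤˣ) (r : V) : Prop :=
  r ∈ G.vertexSet ∧ ∀ v ∈ G.vertexSet, G.HasDitrail v α r (-α)

/-- `G` is an almost strong `α`-radial with root `r`. -/
def IsAlmostStrongRadial (G : BidirectedGraph V E) (α : ℤˣ) (r : V) : Prop :=
  G.IsRadial α r ∧ (∀ v ∈ G.vertexSet, v ≠ r → G.HasDitrail v (-α) r (-α)) ∧
    ¬ G.HasDitrail r (-α) r (-α)

/-- `G` is an `α`-semiradial with root `r`. -/
def IsSemiradial (G : BidirectedGraph V E) (α : ℤˣ) (r : V) : Prop :=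
  r ∈ G.vertexSet ∧ ∀ v ∈ G.vertexSet, G.HasDitrailFrom v α r

/-- `G` is an absolute semiradial with root `r`. -/
def IsAbsoluteSemiradial (G : BidirectedGraph V E) (r : V) : Prop :=
  ∀ α : ℤˣ, G.IsSemiradial α r

/-- `G` is a linear `α`-semiradial with root `r`. -/
def IsLinearSemiradial (G : BidirectedGraph V E) (α : ℤˣ) (r : V) : Prop :=
  G.IsSemiradial α r ∧ ¬ G.HasLoop r ∧
    ∀ x ∈ G.vertexSet, ∀ l b, G.IsDitrail x (-α) l r b → l = []

/-- The vertex `x` is `α`-linear with respect to `r`. -/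
def IsLinearVertex (G : BidirectedGraph V E) (α : ℤˣ) (r x : V) : Prop :=
  G.HasDitrailFrom x α r ∧ ¬ G.HasDitrailFrom x (-α) r

/-- `G` is a sharp `α`-semiradial with root `r`: every neighbor of `r` is linear. -/
def IsSharpSemiradial (G : BidirectedGraph V E) (α : ℤˣ) (r : V) : Prop :=
  G.IsSemiradial α r ∧ ∀ v, v ≠ r → (∃ e a b, G.Joins e r a v b) → G.IsLinearVertex α r v

/-- `H` is a subgraph of `G`. -/
def IsSubgraph (H G : BidirectedGraph V E) : Prop :=
  H.vertexSet ⊆ G.vertexSet ∧ H.edgeSet ⊆ G.edgeSet ∧ ∀ e ∈ H.edgeSet, G.ends e = H.ends e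

/-- `H` is the absolute ground of `G` with respect to `r`: the maximum subgraph that is an absolute
semiradial with root `r`. -/
def IsAbsoluteGround (G : BidirectedGraph V E) (r : V) (H : BidirectedGraph V E) : Prop :=
  H.IsSubgraph G ∧ H.IsAbsoluteSemiradial r ∧
    ∀ H' : BidirectedGraph V E, H'.IsSubgraph G → H'.IsAbsoluteSemiradial r → H'.IsSubgraph H

/-- The edges of `G` at `x`: those in the cut of `x`, and the loops over `x`. -/
def edgesAt (G : BidirectedGraph V E) (x : V) : Set E := {e | ∃ a y b, G.Joins e x a y b}

/-- `K` is a gluing sum `(G; u) ⊕ (H; T)` of the disjoint bidirected graphs `G` and `H` with respect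
to `u` and `T`. -/
def IsGluingSum (G : BidirectedGraph V E) (u : V) (H : BidirectedGraph V E) (T : Set V)
    (K : BidirectedGraph V E) : Prop :=
  Disjoint G.vertexSet H.vertexSet ∧ Disjoint G.edgeSet H.edgeSet ∧
  u ∈ G.vertexSet ∧ T ⊆ H.vertexSet ∧
  K.vertexSet = (G.vertexSet \ {u}) ∪ H.vertexSet ∧
  (G.edgeSet \ G.edgesAt u) ∪ H.edgeSet ⊆ K.edgeSet ∧
  (∀ e ∈ G.edgeSet \ G.edgesAt u, K.ends e = G.ends e) ∧
  (∀ e ∈ H.edgeSet, K.ends e = H.ends e) ∧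
  ∃ f : E → E,
    Set.BijOn f (G.edgesAt u) ((K.edgeSet \ (G.edgeSet \ G.edgesAt u)) \ H.edgeSet) ∧
    (∀ e a v b, v ≠ u → G.Joins e u a v b → ∃ t ∈ T, K.Joins (f e) t a v b) ∧
    (∀ e a b, G.Joins e u a u b → ∃ t₁ ∈ T, ∃ t₂ ∈ T, K.Joins (f e) t₁ a t₂ b)

/-- `G'` is obtained from `G` by adding some edges between `r` and vertices of `G`, over each of
which `r` has the sign `α`. -/
def IsAddEdgesAt (G : BidirectedGraph V E) (α : ℤˣ) (r : V) (G' : BidirectedGraph V E) : Prop :=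
  G'.vertexSet = G.vertexSet ∧ G.IsSubgraph G' ∧
    ∀ e ∈ G'.edgeSet \ G.edgeSet, ∃ v b, G'.Joins e r α v b

mutual

/-- The class of bidirected graphs with vertex `r` that is generated, simultaneously with
`SharpClass`, from almost strong `α`-radials. -/
inductive RoundClass (α : ℤˣ) : BidirectedGraph V E → V → Prop
  | almostStrong (G : BidirectedGraph V E) (r : V) (hG : G.IsAlmostStrongRadial α r) :
      RoundClass α G r
  | addEdges (G G' : BidirectedGraph V E) (r : V) (hG : RoundClass α G r)
      (hG' : G.IsAddEdgesAt α r G') : RoundClass α G' r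
  | glue (G H K : BidirectedGraph V E) (u r : V) (hG : SharpClass α G u)
      (hH : H.IsAlmostStrongRadial α r) (hK : G.IsGluingSum u H (H.vertexSet \ {r}) K) :
      RoundClass α K r

/-- The class of bidirected graphs with vertex `r` that is generated, simultaneously with
`RoundClass`, from linear `α`-semiradials. -/
inductive SharpClass (α : ℤˣ) : BidirectedGraph V E → V → Prop
  | linear (G : BidirectedGraph V E) (r : V) (hG : G.IsLinearSemiradial α r) : SharpClass α G r
  | glue (G H K : BidirectedGraph V E) (u r : V) (hG : RoundClass α G u)
      (hH : H.IsLinearSemiradial α r) (hK : G.IsGluingSum u H (H.vertexSet \ {r}) K) :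
      SharpClass α K r

end

end BidirectedGraph

namespace BidirectedGraph

-- Ditrails and first entries into a set of vertices

section
variable {V E : Type*} {G H K : BidirectedGraph V E} {S : Set V} {x y z r u v t : V}
  {a b c d α σ : ℤˣ} {e : E} {l l₁ l₂ : List E}

-- Both generated classes have intrinsic descriptions: `SharpClass` consists of the sharp
-- `α`-semiradials without a loop over the root, `RoundClass` of the graphs satisfying
-- `IsRoundRadial`. A gluing sum `K` is read backwards: contracting `H` to `u` returns `G`. A
-- ditrail of `K` that ends in `H` alternates between walks in `H` and excursions, which project to
-- ditrails of `G` to `u`. The sign conditions in `G` and `H` limit how these pieces combine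
-- (`isDiwalk_of_sharp`, `not_isDitrail_of_isLinearSemiradial`), so every generating rule preserves
-- the descriptions.
--
-- The converse is an induction on the number of vertices. A greatest set `S` is contracted to a new
-- vertex, which exists because `V` is infinite. In a round radial, `S` collects vertices with
-- ditrails of both first signs inside `S`; a neighbor of the contracted vertex with both signs
-- would give an ear that enlarges `S` (`IsRootedSet.exists_ear`), so the contraction is sharp. In a
-- sharp semiradial, `S` collects linear vertices that reach the root inside `S`; its maximality
-- makes the contraction round.
--
-- The ear argument without restriction on the last sign yields the decomposition of an arbitrary
-- semiradial. Sharpness of `G` then forces every absolute semiradial subgraph into `H`.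

theorem Joins.symm (h : G.Joins e x a y b) : G.Joins e y b x a :=
  ⟨h.1, h.2.trans Sym2.eq_swap⟩

theorem Joins.left_mem (h : G.Joins e x a y b) : x ∈ G.vertexSet :=
  G.mem_vertexSet e h.1 (x, a) (by simp [h.2])

theorem Joins.right_mem (h : G.Joins e x a y b) : y ∈ G.vertexSet :=
  h.symm.left_mem

theorem Joins.eq_or_eq {x' y' : V} {a' b' : ℤˣ} (h : G.Joins e x a y b)
    (h' : G.Joins e x' a' y' b') :
    (x = x' ∧ a = a' ∧ y = y' ∧ b = b') ∨ (x = y' ∧ a = b' ∧ y = x' ∧ b = a') := by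
  have := h.2.symm.trans h'.2
  simp only [Sym2.eq_iff, Prod.mk.injEq] at this
  tauto

theorem exists_joins (he : e ∈ G.edgeSet) : ∃ x a y b, G.Joins e x a y b := by
  induction hs : G.ends e using Sym2.ind with
  | _ p q => exact ⟨p.1, p.2, q.1, q.2, he, hs⟩

theorem eq_neg_of_ne (h : a ≠ b) : a = -b := Int.units_ne_iff_eq_neg.1 h

theorem eq_or_eq_neg (a b : ℤˣ) : a = b ∨ a = -b := or_iff_not_imp_left.2 eq_neg_of_ne

theorem ne_neg_self (a : ℤˣ) : a ≠ -a := by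
  rcases Int.units_eq_one_or a with rfl | rfl <;> decide

namespace IsDiwalk

theorem left_mem (h : G.IsDiwalk x a l y b) : x ∈ G.vertexSet := by
  cases h with
  | nil _ _ hx => exact hx
  | cons _ _ _ _ _ _ _ _ h _ => exact h.left_mem

theorem right_mem (h : G.IsDiwalk x a l y b) : y ∈ G.vertexSet := by
  induction h with
  | nil _ _ hx => exact hx
  | cons _ _ _ _ _ _ _ _ _ _ ih => exact ih

theorem edge_mem (h : G.IsDiwalk x a l y b) : ∀ e ∈ l, e ∈ G.edgeSet := by
  induction h with
  | nil => simp
  | cons _ _ _ _ _ _ _ _ h _ ih => simpa using ⟨h.1, ih⟩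

theorem single (h : G.Joins e x a y b) : G.IsDiwalk x a [e] y b := by
  have := IsDiwalk.nil (G := G) y (-b) h.right_mem
  rw [neg_neg] at this
  exact .cons _ _ _ _ _ _ _ _ h this

theorem append (h : G.IsDiwalk x a l₁ y b) (h' : G.IsDiwalk y (-b) l₂ z c) :
    G.IsDiwalk x a (l₁ ++ l₂) z c := by
  induction h with
  | nil => simpa using h'
  | cons _ _ _ _ _ _ _ _ hj _ ih => exact .cons _ _ _ _ _ _ _ _ hj (ih h')

theorem reverse (h : G.IsDiwalk x a l y b) : G.IsDiwalk y b l.reverse x a := by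
  induction h with
  | nil x a hx =>
    have := IsDiwalk.nil (G := G) x (-a) hx
    rwa [neg_neg] at this
  | cons _ _ _ _ _ _ _ _ hj _ ih =>
    rw [List.reverse_cons]
    exact ih.append (by rw [neg_neg]; exact single hj.symm)

theorem split (h : G.IsDiwalk x a l y b) (he : e ∈ l) :
    ∃ l₁ l₂ p s q t, l = l₁ ++ e :: l₂ ∧ G.Joins e p s q t ∧ G.IsDiwalk x a l₁ p (-s) ∧
      G.IsDiwalk q (-t) l₂ y b := by
  induction h with
  | nil => simp at he
  | cons x a e' y b l z c hj hl ih =>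
    by_cases hee : e = e'
    · subst hee
      exact ⟨[], l, x, a, y, b, rfl, hj, .nil _ _ hj.left_mem, hl⟩
    · obtain ⟨l₁, l₂, p, s, q, t, rfl, h₁, h₂, h₃⟩ := ih (by simpa [hee] using he)
      exact ⟨e' :: l₁, l₂, p, s, q, t, rfl, h₁, .cons _ _ _ _ _ _ _ _ hj h₂, h₃⟩

theorem mono (hG : H.IsSubgraph G) (h : H.IsDiwalk x a l y b) : G.IsDiwalk x a l y b := by
  induction h with
  | nil _ _ hx => exact .nil _ _ (hG.1 hx)
  | cons _ _ e _ _ _ _ _ hj _ ih =>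
    exact .cons _ _ _ _ _ _ _ _ ⟨hG.2.1 hj.1, (hG.2.2 e hj.1).trans hj.2⟩ ih

theorem eq_of_nil (h : G.IsDiwalk x a [] y b) : x = y ∧ b = -a := by
  cases h; exact ⟨rfl, rfl⟩

end IsDiwalk

theorem Joins.mono (hG : H.IsSubgraph G) (h : H.Joins e x a y b) : G.Joins e x a y b :=
  ⟨hG.2.1 h.1, (hG.2.2 e h.1).trans h.2⟩

theorem Joins.of_isSubgraph (hG : H.IsSubgraph G) (h : G.Joins e x a y b) (he : e ∈ H.edgeSet) :
    H.Joins e x a y b :=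
  ⟨he, (hG.2.2 e he).symm.trans h.2⟩

theorem HasDitrail.mono (hG : H.IsSubgraph G) (h : H.HasDitrail x a y b) :
    G.HasDitrail x a y b :=
  h.imp fun _ h => ⟨h.1.mono hG, h.2⟩

theorem HasDitrailFrom.mono (hG : H.IsSubgraph G) (h : H.HasDitrailFrom x a y) :
    G.HasDitrailFrom x a y :=
  h.imp fun _ h => h.mono hG

theorem HasDitrail.nil (hx : x ∈ G.vertexSet) (a : ℤˣ) : G.HasDitrail x a x (-a) :=
  ⟨[], .nil _ _ hx, List.nodup_nil⟩

theorem Joins.hasDitrail (h : G.Joins e x a y b) : G.HasDitrail x a y b :=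
  ⟨[e], .single h, List.nodup_singleton e⟩

/-- A nontrivial diwalk from `x` to `y` all of whose vertices lie outside `S`, with the exception
of the last one, which lies in `S`. -/
inductive Reach (G : BidirectedGraph V E) (S : Set V) : V → ℤˣ → List E → V → ℤˣ → Prop
  | last (x : V) (a : ℤˣ) (e : E) (y : V) (b : ℤˣ) (hx : x ∉ S) (hy : y ∈ S)
      (h : G.Joins e x a y b) : Reach G S x a [e] y b
  | cons (x : V) (a : ℤˣ) (e : E) (y : V) (b : ℤˣ) (l : List E) (z : V) (c : ℤˣ) (hx : x ∉ S)
      (h : G.Joins e x a y b) (hl : Reach G S y (-b) l z c) : Reach G S x a (e :: l) z c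

namespace Reach

theorem isDiwalk (h : G.Reach S x a l y b) : G.IsDiwalk x a l y b := by
  induction h with
  | last _ _ _ _ _ _ _ h => exact .single h
  | cons _ _ _ _ _ _ _ _ _ h _ ih => exact .cons _ _ _ _ _ _ _ _ h ih

theorem left_notMem (h : G.Reach S x a l y b) : x ∉ S := by
  cases h <;> assumption

theorem right_mem (h : G.Reach S x a l y b) : y ∈ S := by
  induction h <;> assumption

theorem hasDitrail (h : G.Reach S x a l y b) (hl : l.Nodup) : G.HasDitrail x a y b :=
  ⟨l, h.isDiwalk, hl⟩

theorem exists_last (h : G.Reach S x a l y b) :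
    ∃ e v c, v ∉ S ∧ G.Joins e v c y b := by
  induction h with
  | last x a e y b hx hy h => exact ⟨e, x, a, hx, h⟩
  | cons _ _ _ _ _ _ _ _ _ _ _ ih => exact ih

/-- Every edge other than the last one has both ends outside `S`. -/
theorem notMem_of_append (h : G.Reach S x a (l₁ ++ l₂) y b) (hl₂ : l₂ ≠ []) (he : e ∈ l₁) {v w : V}
    {c d : ℤˣ} (hj : G.Joins e v c w d) : v ∉ S := by
  induction l₁ generalizing x a with
  | nil => simp at he
  | cons e' l₁ ih =>
    rw [List.cons_append] at h
    generalize hm : l₁ ++ l₂ = m at h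
    cases h with
    | last => simp_all
    | cons _ _ _ y' b' _ _ _ hx h hl =>
      subst hm
      rcases List.mem_cons.1 he with rfl | he
      · rcases hj.eq_or_eq h with ⟨rfl, -⟩ | ⟨rfl, -⟩
        · exact hx
        · exact hl.left_notMem
      · exact ih hl he

/-- Every edge has an end outside `S`. -/
theorem exists_joins_notMem (h : G.Reach S x a l y b) (he : e ∈ l) :
    ∃ v c w d, G.Joins e v c w d ∧ v ∉ S := by
  induction h with
  | last x a e' y b hx hy h =>
    rw [List.mem_singleton.1 he]
    exact ⟨_, _, _, _, h, hx⟩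
  | cons x a e' y b l z c hx h hl ih =>
    rcases List.mem_cons.1 he with rfl | he
    · exact ⟨_, _, _, _, h, hx⟩
    · exact ih he

end Reach

theorem IsDiwalk.first_hit (h : G.IsDiwalk x a l y b) (hx : x ∉ S) (hy : y ∈ S) :
    ∃ l₁ l₂ z c, l = l₁ ++ l₂ ∧ G.Reach S x a l₁ z c ∧ G.IsDiwalk z (-c) l₂ y b := by
  induction h with
  | nil => exact absurd hy hx
  | cons x a e y b l z c hj hl ih =>
    by_cases hyS : y ∈ S
    · exact ⟨[e], l, y, b, rfl, .last _ _ _ _ _ hx hyS hj, hl⟩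
    · obtain ⟨l₁, l₂, z', c', rfl, h₁, h₂⟩ := ih hyS hy
      exact ⟨e :: l₁, l₂, z', c', rfl, .cons _ _ _ _ _ _ _ _ hx hj h₁, h₂⟩

theorem HasDitrail.first_hit (h : G.HasDitrail x a y b) (hx : x ∉ S) (hy : y ∈ S) :
    ∃ l z c, l.Nodup ∧ G.Reach S x a l z c ∧ G.HasDitrail z (-c) y b := by
  obtain ⟨l, hl, hn⟩ := h
  obtain ⟨l₁, l₂, z, c, rfl, h₁, h₂⟩ := hl.first_hit hx hy
  rw [List.nodup_append] at hn
  exact ⟨l₁, z, c, hn.1, h₁, l₂, h₂, hn.2.1⟩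

/-- If no `(-α, -α)`-ditrail leads from `r` to `r`, then an `(a, -α)`-ditrail to `r` can be chosen
to meet `r` only at its end. -/
theorem HasDitrail.exists_reach (h : G.HasDitrail x a r (-α)) (hr : ¬ G.HasDitrail r (-α) r (-α))
    (hx : x ≠ r) : ∃ l, l.Nodup ∧ G.Reach {r} x a l r (-α) := by
  obtain ⟨l, z, c, hn, hl, h'⟩ := h.first_hit (S := {r}) hx rfl
  obtain rfl : z = r := hl.right_mem
  rcases eq_or_eq_neg c α with rfl | rfl
  · exact absurd h' hr
  · exact ⟨l, hn, hl⟩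

/-- A closed `(-α, -α)`-ditrail contains one that meets `r` only at its ends. -/
theorem IsDitrail.exists_closed (h : G.IsDitrail r (-α) l r (-α)) :
    (∃ e, G.Joins e r (-α) r (-α)) ∨ ∃ e l y b, (e :: l).Nodup ∧ G.Joins e r (-α) y b ∧
      G.Reach {r} y (-b) l r (-α) := by
  induction hn : l.length using Nat.strong_induction_on generalizing l with
  | _ n ih =>
    obtain ⟨h, hnd⟩ := h
    rcases l with - | ⟨e, l⟩
    · exact absurd h.eq_of_nil.2 (ne_neg_self _)
    cases h with
    | cons _ _ _ y b _ _ _ hj hl =>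
      by_cases hy : y = r
      · subst hy
        rcases eq_or_eq_neg b α with rfl | rfl
        · exact ih _ (by simp [← hn]) ⟨hl, hnd.of_cons⟩ rfl
        · exact .inl ⟨e, hj⟩
      · obtain ⟨l₁, l₂, z, c, rfl, h₁, h₂⟩ := hl.first_hit (S := {r}) hy rfl
        obtain rfl : z = r := h₁.right_mem
        rcases eq_or_eq_neg c α with rfl | rfl
        · refine ih l₂.length (by simp [← hn]) ⟨h₂, ?_⟩ rfl
          exact (List.nodup_append.1 hnd.of_cons).2.1
        · refine .inr ⟨e, l₁, y, b, ?_, hj, h₁⟩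
          exact hnd.sublist (by simp)

end

-- Gluing sums as reversed contractions

section
variable {V E : Type*} {G H K : BidirectedGraph V E} {S T X : Set V} {B : Set ℤˣ}
  {x y z r u v t w p : V} {a b c d α σ : ℤˣ} {e : E} {l l₁ l₂ : List E} {g : E → E}

open Classical in
/-- The map that identifies all vertices of `S` with `u`. -/
noncomputable def collapse (S : Set V) (u x : V) : V := if x ∈ S then u else x

theorem collapse_of_mem (h : x ∈ S) : collapse S u x = u := if_pos h

theorem collapse_of_notMem (h : x ∉ S) : collapse S u x = x := if_neg h

/-- `G` arises from `K` by contracting the subgraph `H` to the vertex `u`, where the edge `e` of `G`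
corresponds to the edge `g e` of `K`, and the edges of `K` outside `H` meet `H` only in `T`. -/
structure Contraction (G : BidirectedGraph V E) (u : V) (H : BidirectedGraph V E) (T : Set V)
    (K : BidirectedGraph V E) (g : E → E) : Prop where
  disjoint : Disjoint G.vertexSet H.vertexSet
  mem : u ∈ G.vertexSet
  subset : T ⊆ H.vertexSet
  vertexSet_eq : K.vertexSet = (G.vertexSet \ {u}) ∪ H.vertexSet
  isSubgraph : H.IsSubgraph K
  bijOn : Set.BijOn g G.edgeSet (K.edgeSet \ H.edgeSet)
  joins : ∀ e ∈ G.edgeSet, ∀ x a y b, K.Joins (g e) x a y b →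
    G.Joins e (collapse H.vertexSet u x) a (collapse H.vertexSet u y) b
  port : ∀ e ∈ G.edgeSet, ∀ x a y b, K.Joins (g e) x a y b → x ∈ H.vertexSet → x ∈ T

/-- An edge has only two orientations, so checking one of them suffices. -/
theorem joins_collapse_of_joins {p q : V × ℤˣ}
    (h : K.Joins (g e) p.1 p.2 q.1 q.2)
    (h' : G.Joins e (collapse S u p.1) p.2 (collapse S u q.1) q.2)
    (hp : p.1 ∈ S → p.1 ∈ T) (hq : q.1 ∈ S → q.1 ∈ T) :
    ∀ x a y b, K.Joins (g e) x a y b →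
      G.Joins e (collapse S u x) a (collapse S u y) b ∧ (x ∈ S → x ∈ T) := by
  intro x a y b hx
  rcases hx.eq_or_eq h with ⟨rfl, rfl, rfl, rfl⟩ | ⟨rfl, rfl, rfl, rfl⟩
  · exact ⟨h', hp⟩
  · exact ⟨h'.symm, hq⟩

theorem IsGluingSum.exists_contraction (h : G.IsGluingSum u H T K) :
    ∃ g, Contraction G u H T K g := by
  classical
  obtain ⟨hd, hde, hu, hT, hV, hE, hG, hH, f, hf, hf₁, hf₂⟩ := h
  have hat : G.edgesAt u ⊆ G.edgeSet := fun e ⟨_, _, _, he⟩ => he.1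
  -- The gluing bijection moves only the edges at `u`; all other edges of `G` keep their names in
  -- `K`.
  let g : E → E := fun e => if e ∈ G.edgesAt u then f e else e
  have key : ∀ e ∈ G.edgeSet, ∀ x a y b, K.Joins (g e) x a y b →
      G.Joins e (collapse H.vertexSet u x) a (collapse H.vertexSet u y) b ∧
        (x ∈ H.vertexSet → x ∈ T) := by
    intro e he
    have hu' : ∀ {v}, v ∈ G.vertexSet → v ∉ H.vertexSet :=
      fun hv hv' => Set.disjoint_left.1 hd hv hv'
    by_cases heu : e ∈ G.edgesAt u
    · have hg : g e = f e := if_pos heu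
      obtain ⟨a, v, b, hj⟩ := heu
      by_cases hv : v = u
      · subst hv
        obtain ⟨t₁, ht₁, t₂, ht₂, hK⟩ := hf₂ e a b hj
        refine joins_collapse_of_joins (p := (t₁, a)) (q := (t₂, b)) (hg ▸ hK) ?_
          (fun _ => ht₁) (fun _ => ht₂)
        simpa [collapse_of_mem (hT ht₁), collapse_of_mem (hT ht₂)] using hj
      · obtain ⟨t, ht, hK⟩ := hf₁ e a v b hv hj
        refine joins_collapse_of_joins (p := (t, a)) (q := (v, b)) (hg ▸ hK) ?_
          (fun _ => ht) (fun h => absurd h (hu' hj.right_mem))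
        simpa [collapse_of_mem (hT ht), collapse_of_notMem (hu' hj.right_mem)] using hj
    · have hg : g e = e := if_neg heu
      obtain ⟨x, a, y, b, hj⟩ := exists_joins he
      have hK : K.Joins e x a y b := ⟨hE (.inl ⟨he, heu⟩), (hG e ⟨he, heu⟩).trans hj.2⟩
      refine joins_collapse_of_joins (p := (x, a)) (q := (y, b)) (by rwa [hg]) ?_
          (fun h => absurd h (hu' hj.left_mem)) (fun h => absurd h (hu' hj.right_mem))
      simpa [collapse_of_notMem (hu' hj.left_mem), collapse_of_notMem (hu' hj.right_mem)] using hj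
  refine ⟨g, hd, hu, hT, hV, ⟨?_, fun e he => hE (.inr he), hH⟩, ?_,
    fun e he x a y b hx => (key e he x a y b hx).1, fun e he x a y b hx => (key e he x a y b hx).2⟩
  · rw [hV]; exact Set.subset_union_right
  · have h₁ : Set.BijOn g (G.edgesAt u)
        ((K.edgeSet \ (G.edgeSet \ G.edgesAt u)) \ H.edgeSet) :=
      hf.congr fun e he => (if_pos he).symm
    have h₂ : Set.BijOn g (G.edgeSet \ G.edgesAt u) (G.edgeSet \ G.edgesAt u) :=
      (Set.bijOn_id _).congr fun e he => (if_neg he.2).symm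
    have h₃ := h₁.union h₂ (by
      rw [Set.injOn_union (Set.disjoint_sdiff_right)]
      refine ⟨h₁.injOn, h₂.injOn, fun x hx y hy hxy => ?_⟩
      have := h₁.mapsTo hx
      rw [hxy] at this
      exact this.1.2 (h₂.mapsTo hy))
    have e₁ : G.edgesAt u ∪ G.edgeSet \ G.edgesAt u = G.edgeSet :=
      Set.union_sdiff_cancel hat
    have e₂ : (K.edgeSet \ (G.edgeSet \ G.edgesAt u)) \ H.edgeSet ∪ G.edgeSet \ G.edgesAt u =
        K.edgeSet \ H.edgeSet := by
      ext e
      have h₄ : e ∈ G.edgeSet \ G.edgesAt u → e ∈ K.edgeSet := fun h => hE (.inl h)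
      have h₅ : e ∈ G.edgeSet \ G.edgesAt u → e ∉ H.edgeSet :=
        fun h h' => Set.disjoint_left.1 hde h.1 h'
      simp only [Set.mem_union, Set.mem_sdiff] at h₄ h₅ ⊢
      tauto
    rwa [e₁, e₂] at h₃

namespace Contraction

theorem exists_edge (h : Contraction G u H T K g) (he : e ∈ K.edgeSet) (he' : e ∉ H.edgeSet) :
    ∃ e' ∈ G.edgeSet, g e' = e :=
  h.bijOn.surjOn ⟨he, he'⟩

theorem notMem (h : Contraction G u H T K g) (hx : x ∈ G.vertexSet) : x ∉ H.vertexSet :=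
  fun hx' => Set.disjoint_left.1 h.disjoint hx hx'

theorem root_notMem (h : Contraction G u H T K g) : u ∉ K.vertexSet := by
  rw [h.vertexSet_eq]
  rintro (h' | h')
  · exact h'.2 rfl
  · exact h.notMem h.mem h'

theorem mem_of_notMem (h : Contraction G u H T K g) (hx : x ∈ K.vertexSet)
    (hx' : x ∉ H.vertexSet) : x ∈ G.vertexSet ∧ x ≠ u := by
  rw [h.vertexSet_eq] at hx
  exact hx.resolve_right hx'

theorem mem_of_ne (h : Contraction G u H T K g) (hx : x ∈ G.vertexSet) (hx' : x ≠ u) :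
    x ∈ K.vertexSet := by
  rw [h.vertexSet_eq]
  exact .inl ⟨hx, hx'⟩

theorem mem_of_collapse_eq (h : Contraction G u H T K g) (hx : x ∈ K.vertexSet)
    (hx' : collapse H.vertexSet u x = u) : x ∈ H.vertexSet := by
  by_contra hxH
  rw [collapse_of_notMem hxH] at hx'
  exact h.root_notMem (hx' ▸ hx)

theorem eq_of_collapse_eq (hx : collapse S u x = y) (hy : y ≠ u) : x = y ∧ x ∉ S := by
  by_cases hxS : x ∈ S
  · rw [collapse_of_mem hxS] at hx
    exact absurd hx.symm hy
  · rw [collapse_of_notMem hxS] at hx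
    exact ⟨hx, hxS⟩

theorem exists_joins (h : Contraction G u H T K g) (hj : G.Joins e x a y b) :
    ∃ x' y', K.Joins (g e) x' a y' b ∧ collapse H.vertexSet u x' = x ∧
      collapse H.vertexSet u y' = y := by
  obtain ⟨x', a', y', b', hK⟩ := BidirectedGraph.exists_joins (h.bijOn.mapsTo hj.1).1
  rcases hj.eq_or_eq (h.joins e hj.1 _ _ _ _ hK) with ⟨rfl, rfl, rfl, rfl⟩ | ⟨rfl, rfl, rfl, rfl⟩
  · exact ⟨x', y', hK, rfl, rfl⟩
  · exact ⟨y', x', hK.symm, rfl, rfl⟩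

theorem exists_joins_root (h : Contraction G u H T K g) (hj : G.Joins e x a u b) (hx : x ≠ u) :
    ∃ t ∈ T, K.Joins (g e) x a t b ∧ x ∉ H.vertexSet := by
  obtain ⟨x', y', hK, hx', hy'⟩ := h.exists_joins hj
  obtain ⟨rfl, hxH⟩ := eq_of_collapse_eq hx' hx
  exact ⟨y', h.port e hj.1 _ _ _ _ hK.symm (h.mem_of_collapse_eq hK.right_mem hy'), hK, hxH⟩

theorem reach_project (h : Contraction G u H T K g) (hl : K.Reach H.vertexSet x a l t d) :
    t ∈ T ∧ ∃ l', l = l'.map g ∧ G.Reach {u} x a l' u d := by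
  induction hl with
  | last x a e y b hx hy hj =>
    have he : e ∉ H.edgeSet := fun he => hx (hj.of_isSubgraph h.isSubgraph he).left_mem
    obtain ⟨e, he', rfl⟩ := h.exists_edge hj.1 he
    have hG := h.joins e he' _ _ _ _ hj
    rw [collapse_of_mem hy, collapse_of_notMem hx] at hG
    exact ⟨h.port e he' _ _ _ _ hj.symm hy, [e], rfl,
      .last _ _ _ _ _ (h.mem_of_notMem hj.left_mem hx).2 rfl hG⟩
  | cons x a e y b l z c hx hj hl ih =>
    have he : e ∉ H.edgeSet := fun he => hx (hj.of_isSubgraph h.isSubgraph he).left_mem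
    obtain ⟨e, he', rfl⟩ := h.exists_edge hj.1 he
    have hG := h.joins e he' _ _ _ _ hj
    rw [collapse_of_notMem hl.left_notMem, collapse_of_notMem hx] at hG
    obtain ⟨ht, l', rfl, hl'⟩ := ih
    exact ⟨ht, e :: l', rfl, .cons _ _ _ _ _ _ _ _ (h.mem_of_notMem hj.left_mem hx).2 hG hl'⟩

/-- The walk must not pass through `u` earlier: consecutive edges at `u` may be attached to
different vertices of `H`. -/
theorem reach_lift (h : Contraction G u H T K g) (hl : G.Reach {u} x a l u d) :
    ∃ t ∈ T, K.Reach H.vertexSet x a (l.map g) t d := by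
  generalize hS : ({u} : Set V) = S at hl
  generalize hz : u = z at hl
  induction hl with
  | last x a e y b hx hy hj =>
    subst hS hz
    obtain ⟨t, ht, hK, hxH⟩ := h.exists_joins_root hj hx
    exact ⟨t, ht, .last _ _ _ _ _ hxH (h.subset ht) hK⟩
  | cons x a e y b l z c hx hj hl ih =>
    obtain ⟨t, ht, hK⟩ := ih hz
    subst hS hz
    obtain ⟨x', y', hK', hx', hy'⟩ := h.exists_joins hj
    obtain ⟨rfl, hxH⟩ := eq_of_collapse_eq hx' hx
    obtain ⟨rfl, hyH⟩ := eq_of_collapse_eq hy' hl.left_notMem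
    exact ⟨t, ht, .cons _ _ _ _ _ _ _ _ hxH hK' hK⟩

theorem nodup_map (h : Contraction G u H T K g) (hl : ∀ e ∈ l, e ∈ G.edgeSet) (hn : l.Nodup) :
    (l.map g).Nodup :=
  hn.map_on fun _ hx _ hy hxy => h.bijOn.injOn (hl _ hx) (hl _ hy) hxy

/-- A ditrail of `K` from outside `H` to `H` starts with a ditrail of `G` to the contracted
vertex. -/
theorem hasDitrail_project (h : Contraction G u H T K g) (hK : K.HasDitrail x a y b)
    (hx : x ∉ H.vertexSet) (hy : y ∈ H.vertexSet) :
    ∃ d, ∃ t ∈ T, G.HasDitrail x a u d ∧ K.HasDitrail t (-d) y b := by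
  obtain ⟨l, t, d, hn, hl, h'⟩ := hK.first_hit hx hy
  obtain ⟨ht, l', rfl, hl'⟩ := h.reach_project hl
  exact ⟨d, t, ht, hl'.hasDitrail hn.of_map, h'⟩

/-- Only the segment up to the first visit of `u` lifts, so control over the last sign is lost. -/
theorem hasDitrail_lift (h : Contraction G u H T K g) (hG : G.HasDitrail x a u b)
    (hx : x ≠ u) : ∃ l, l.Nodup ∧ ∃ d, ∃ t ∈ T, K.Reach H.vertexSet x a l t d := by
  obtain ⟨l, z, d, hn, hl, -⟩ := hG.first_hit (S := {u}) hx rfl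
  obtain rfl : z = u := hl.right_mem
  obtain ⟨t, ht, h'⟩ := h.reach_lift hl
  exact ⟨_, h.nodup_map hl.isDiwalk.edge_mem hn, d, t, ht, h'⟩

end Contraction

theorem IsDitrail.append_hasDitrail (hH : H.IsSubgraph K) (hl : K.IsDitrail x a l t d)
    (hl' : ∀ e ∈ l, e ∉ H.edgeSet) (ht : H.HasDitrail t (-d) r c) : K.HasDitrail x a r c := by
  obtain ⟨l₂, h₂, hn₂⟩ := ht
  refine ⟨l ++ l₂, hl.1.append (h₂.mono hH), List.nodup_append.2 ⟨hl.2, hn₂, ?_⟩⟩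
  rintro e he _ he' rfl
  exact hl' e he (h₂.edge_mem e he')

theorem Reach.notMem_edgeSet (hH : H.IsSubgraph K) (hl : K.Reach H.vertexSet x a l t d) :
    ∀ e ∈ l, e ∉ H.edgeSet := by
  intro e he he'
  obtain ⟨v, c, w, d, hj, hv⟩ := hl.exists_joins_notMem he
  exact hv (hj.of_isSubgraph hH he').left_mem

theorem Reach.append_hasDitrail (hH : H.IsSubgraph K) (hl : K.Reach H.vertexSet x a l t d)
    (hn : l.Nodup) (ht : H.HasDitrail t (-d) r c) : K.HasDitrail x a r c :=
  IsDitrail.append_hasDitrail hH ⟨hl.isDiwalk, hn⟩ (hl.notMem_edgeSet hH) ht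

/-- The subgraph of `K` induced by the vertices in `S`. -/
def induce (K : BidirectedGraph V E) (S : Set V) : BidirectedGraph V E where
  vertexSet := K.vertexSet ∩ S
  edgeSet := {e ∈ K.edgeSet | ∀ p ∈ K.ends e, p.1 ∈ S}
  ends := K.ends
  finite_vertexSet := K.finite_vertexSet.inter_of_left S
  finite_edgeSet := K.finite_edgeSet.subset fun _ h => h.1
  mem_vertexSet e he p hp := ⟨K.mem_vertexSet e he.1 p hp, he.2 p hp⟩

theorem induce_isSubgraph : (K.induce S).IsSubgraph K :=
  ⟨fun _ h => h.1, fun _ h => h.1, fun _ _ => rfl⟩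

theorem induce_mono (h : S ⊆ T) : (K.induce S).IsSubgraph (K.induce T) :=
  ⟨fun _ hx => ⟨hx.1, h hx.2⟩, fun _ he => ⟨he.1, fun p hp => h (he.2 p hp)⟩, fun _ _ => rfl⟩

theorem vertexSet_induce (h : S ⊆ K.vertexSet) : (K.induce S).vertexSet = S :=
  Set.inter_eq_right.2 h

theorem Joins.induce (h : K.Joins e x a y b) (hx : x ∈ S) (hy : y ∈ S) :
    (K.induce S).Joins e x a y b :=
  ⟨⟨h.1, by simp [h.2, hx, hy]⟩, h.2⟩

theorem IsDiwalk.of_edge_mem (hH : H.IsSubgraph K) (h : K.IsDiwalk x a l y b)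
    (hx : x ∈ H.vertexSet) (hl : ∀ e ∈ l, e ∈ H.edgeSet) : H.IsDiwalk x a l y b := by
  induction h with
  | nil => exact .nil _ _ hx
  | cons x a e y b l z c hj _ ih =>
    have := hj.of_isSubgraph hH (hl e (by simp))
    exact .cons _ _ _ _ _ _ _ _ this (ih this.right_mem fun e he => hl e (by simp [he]))

theorem Reach.of_edge_mem (hH : H.IsSubgraph K) (h : K.Reach S x a l y b)
    (hl : ∀ e ∈ l, e ∈ H.edgeSet) : H.Reach S x a l y b := by
  induction h with
  | last x a e y b hx hy hj => exact .last _ _ _ _ _ hx hy (hj.of_isSubgraph hH (hl e (by simp)))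
  | cons x a e y b l z c hx hj _ ih =>
    have := hj.of_isSubgraph hH (hl e (by simp))
    exact .cons _ _ _ _ _ _ _ _ hx this (ih fun e he => hl e (by simp [he]))

/-- The graph obtained from `K` by contracting the vertices in `S` to the vertex `u` and deleting
the resulting loops. -/
noncomputable def contract (K : BidirectedGraph V E) (S : Set V) (u : V) : BidirectedGraph V E where
  vertexSet := insert u (K.vertexSet \ S)
  edgeSet := K.edgeSet \ (K.induce S).edgeSet
  ends e := (K.ends e).map (Prod.map (collapse S u) id)
  finite_vertexSet := K.finite_vertexSet.sdiff.insert u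
  finite_edgeSet := K.finite_edgeSet.sdiff
  mem_vertexSet e he p hp := by
    obtain ⟨q, hq, rfl⟩ := Sym2.mem_map.1 hp
    by_cases hqS : q.1 ∈ S
    · simp [collapse_of_mem hqS]
    · simp [collapse_of_notMem hqS, hqS, K.mem_vertexSet e he.1 q hq]

theorem Joins.contract (h : K.Joins e x a y b) (he : e ∉ (K.induce S).edgeSet) :
    (K.contract S u).Joins e (collapse S u x) a (collapse S u y) b :=
  ⟨⟨h.1, he⟩, by simp [BidirectedGraph.contract, h.2]⟩

theorem exists_joins_of_contract (h : (K.contract S u).Joins e x a y b) :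
    ∃ x' y', K.Joins e x' a y' b ∧ collapse S u x' = x ∧ collapse S u y' = y := by
  obtain ⟨x', a', y', b', hK⟩ := exists_joins h.1.1
  rcases h.eq_or_eq (hK.contract h.1.2) with ⟨rfl, rfl, rfl, rfl⟩ | ⟨rfl, rfl, rfl, rfl⟩
  · exact ⟨x', y', hK, rfl, rfl⟩
  · exact ⟨y', x', hK.symm, rfl, rfl⟩

theorem not_hasLoop_contract (hu : u ∉ K.vertexSet) : ¬ (K.contract S u).HasLoop u := by
  rintro ⟨e, a, b, h⟩
  obtain ⟨x, y, hK, hx, hy⟩ := exists_joins_of_contract h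
  have key : ∀ {x}, x ∈ K.vertexSet → collapse S u x = u → x ∈ S := by
    intro x hx hxu
    by_contra hxS
    rw [collapse_of_notMem hxS] at hxu
    exact hu (hxu ▸ hx)
  exact h.1.2 (hK.induce (key hK.left_mem hx) (key hK.right_mem hy)).1

/-- Edges keep their names under `contract`, so the identity serves as edge bijection. The clause on
loops over `u` is vacuous, as these have been deleted. -/
theorem isGluingSum_contract (hu : u ∉ K.vertexSet) (hS : S ⊆ K.vertexSet) (hT : T ⊆ S)
    (hp : ∀ e x a y b, K.Joins e x a y b → x ∈ S → y ∉ S → x ∈ T) :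
    (K.contract S u).IsGluingSum u (K.induce S) T K := by
  have huS : u ∉ S := fun h => hu (hS h)
  have hnl := not_hasLoop_contract (S := S) hu
  have hjo : ∀ e a v b, v ≠ u → (K.contract S u).Joins e u a v b →
      ∃ t ∈ T, K.Joins e t a v b := by
    intro e a v b hv hj
    obtain ⟨x, y, hK, hx, hy⟩ := exists_joins_of_contract hj
    obtain ⟨rfl, hyS⟩ := Contraction.eq_of_collapse_eq hy hv
    refine ⟨x, hp e _ _ _ _ hK ?_ hyS, hK⟩
    by_contra hxS
    rw [collapse_of_notMem hxS] at hx
    exact hu (hx ▸ hK.left_mem)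
  refine ⟨?_, ?_, .inl rfl, ?_, ?_, ?_, ?_, fun _ _ => rfl, id, ?_, hjo, ?_⟩
  · rw [vertexSet_induce hS, Set.disjoint_left]
    rintro x (rfl | hx) hxS
    · exact huS hxS
    · exact hx.2 hxS
  · exact Set.disjoint_sdiff_left
  · rwa [vertexSet_induce hS]
  · rw [vertexSet_induce hS]
    ext x
    simp only [contract, Set.mem_union, Set.mem_sdiff, Set.mem_insert_iff, Set.mem_singleton_iff]
    have h₁ : x ∈ S → x ∈ K.vertexSet := fun h => hS h
    have h₂ : x = u → x ∉ K.vertexSet := fun h => h ▸ hu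
    tauto
  · rintro e (he | he)
    · exact he.1.1
    · exact he.1
  · rintro e ⟨he, heu⟩
    obtain ⟨x, a, y, b, hK⟩ := exists_joins he.1
    have hG := hK.contract (u := u) he.2
    have hx : x ∉ S := fun hx => heu ⟨a, _, b, by rwa [collapse_of_mem hx] at hG⟩
    have hy : y ∉ S := fun hy => heu ⟨b, _, a, by rw [collapse_of_mem hy] at hG; exact hG.symm⟩
    rw [collapse_of_notMem hx, collapse_of_notMem hy] at hG
    exact hK.2.trans hG.2.symm
  · have : (K.contract S u).edgesAt u =
        (K.edgeSet \ ((K.contract S u).edgeSet \ (K.contract S u).edgesAt u)) \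
          (K.induce S).edgeSet := by
      ext e
      have h₁ : e ∈ (K.contract S u).edgesAt u → e ∈ (K.contract S u).edgeSet :=
        fun ⟨_, _, _, h⟩ => h.1
      have h₂ : e ∈ (K.contract S u).edgeSet ↔ e ∈ K.edgeSet ∧ e ∉ (K.induce S).edgeSet := Iff.rfl
      simp only [Set.mem_sdiff]
      tauto
    rw [← this]
    exact Set.bijOn_id _
  · intro e a b h
    exact absurd ⟨e, a, b, h⟩ hnl

end

-- Invariants preserved by the generating rules

section
variable {V E : Type*} {G G' H K : BidirectedGraph V E} {S T X : Set V} {B : Set ℤˣ}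
  {x y z r u v t w p : V} {a b c d α σ : ℤˣ} {e : E} {l l₁ l₂ : List E} {g : E → E}

/-- An `α`-radial with root `r` without closed `(-α, -α)`-ditrails at `r`, in which `r` has the
sign `-α` only over edges to vertices with `(-α, -α)`-ditrails to `r`. -/
def IsRoundRadial (G : BidirectedGraph V E) (α : ℤˣ) (r : V) : Prop :=
  G.IsRadial α r ∧ ¬ G.HasDitrail r (-α) r (-α) ∧
    ∀ e v b, v ≠ r → G.Joins e r (-α) v b → G.HasDitrail v (-α) r (-α)

/-- If the ditrail from `y` already uses `e`, its part from `e` onwards is a ditrail that starts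
with `e` in one of the two directions. -/
theorem HasDitrailFrom.cons (hj : G.Joins e x a y b) (h : G.HasDitrailFrom y (-b) r) :
    G.HasDitrailFrom x a r ∨ G.HasDitrailFrom y b r := by
  obtain ⟨c, l, hl, hn⟩ := h
  by_cases he : e ∈ l
  · obtain ⟨l₁, l₂, p, s, q, t, rfl, hj', h₁, h₂⟩ := hl.split he
    have hn₂ := (List.nodup_append.1 hn).2.1
    rcases hj.eq_or_eq hj' with ⟨rfl, rfl, rfl, rfl⟩ | ⟨rfl, rfl, rfl, rfl⟩
    · exact .inl ⟨c, _, .cons _ _ _ _ _ _ _ _ hj h₂, hn₂⟩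
    · exact .inr ⟨c, _, .cons _ _ _ _ _ _ _ _ hj.symm h₂, hn₂⟩
  · exact .inl ⟨c, _, .cons _ _ _ _ _ _ _ _ hj hl, List.nodup_cons.2 ⟨he, hn⟩⟩

namespace IsLinearSemiradial

theorem not_hasDitrailFrom (h : G.IsLinearSemiradial α r) (hx : x ≠ r) :
    ¬ G.HasDitrailFrom x (-α) r := by
  rintro ⟨b, l, hl⟩
  obtain rfl := h.2.2 x hl.1.left_mem l b hl
  exact hx hl.1.eq_of_nil.1

theorem isSharpSemiradial (h : G.IsLinearSemiradial α r) : G.IsSharpSemiradial α r :=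
  ⟨h.1, fun v hv ⟨_, _, _, hj⟩ => ⟨h.1.2 v hj.right_mem, h.not_hasDitrailFrom hv⟩⟩

theorem eq_of_joins_root (h : G.IsLinearSemiradial α r) (hj : G.Joins e x a r b) (hx : x ≠ r) :
    a = α := by
  by_contra ha
  obtain rfl := eq_neg_of_ne ha
  exact h.not_hasDitrailFrom hx ⟨_, hj.hasDitrail⟩

/-- Such an edge, put before an `α`-ditrail of `y`, would give `x` or `y` a `-α`-ditrail. -/
theorem not_joins (h : G.IsLinearSemiradial α r) (hx : x ≠ r) (hy : y ≠ r) :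
    ¬ G.Joins e x (-α) y (-α) := by
  intro hj
  rcases HasDitrailFrom.cons hj (by rw [neg_neg]; exact h.1.2 y hj.right_mem) with h' | h'
  · exact h.not_hasDitrailFrom hx h'
  · exact h.not_hasDitrailFrom hy h'

end IsLinearSemiradial

namespace Contraction

/-- A ditrail from outside enters `H` with an uncontrolled sign; hence both signs are required at
the vertices of `T`. -/
theorem isSemiradial (h : Contraction G u H T K g) (hG : G.IsSemiradial α u)
    (hH : r ∈ H.vertexSet) (hHα : ∀ t ∈ H.vertexSet, H.HasDitrailFrom t α r)
    (hT : ∀ t ∈ T, ∀ σ, H.HasDitrailFrom t σ r) : K.IsSemiradial α r := by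
  refine ⟨h.isSubgraph.1 hH, fun v hv => ?_⟩
  by_cases hvH : v ∈ H.vertexSet
  · exact (hHα v hvH).mono h.isSubgraph
  · obtain ⟨hvG, hvu⟩ := h.mem_of_notMem hv hvH
    obtain ⟨b, hb⟩ := hG.2 v hvG
    obtain ⟨l, hn, d, t, ht, hl⟩ := h.hasDitrail_lift hb hvu
    obtain ⟨c, hc⟩ := hT t ht (-d)
    exact ⟨c, hl.append_hasDitrail h.isSubgraph hn hc⟩

/-- The edge of `G` to `u` and the ditrail to `u` obtained from a ditrail of `K` that leaves `H`
and comes back. -/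
theorem exists_excursion (h : Contraction G u H T K g) (hj : K.Joins e x a y b)
    (hx : x ∈ H.vertexSet) (hy : y ∉ H.vertexSet) (hl : K.IsDiwalk y (-b) l z c)
    (hz : z ∈ H.vertexSet) (hn : (e :: l).Nodup) :
    ∃ e' l' l₁ l₂ t d, l = l₁ ++ l₂ ∧ t ∈ T ∧ G.Joins e' u a y b ∧ G.Reach {u} y (-b) l' u d ∧
      (e' :: l').Nodup ∧ K.IsDiwalk t (-d) l₂ z c := by
  have he : e ∉ H.edgeSet := fun he => hy (hj.of_isSubgraph h.isSubgraph he).right_mem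
  obtain ⟨e, he', rfl⟩ := h.exists_edge hj.1 he
  have hG := h.joins e he' _ _ _ _ hj
  rw [collapse_of_mem hx, collapse_of_notMem hy] at hG
  obtain ⟨l₁, l₂, t, d, rfl, h₁, h₂⟩ := hl.first_hit hy hz
  obtain ⟨ht, l', rfl, hl'⟩ := h.reach_project h₁
  refine ⟨e, l', _, l₂, t, d, rfl, ht, hG, hl', ?_, h₂⟩
  refine List.Nodup.of_map g (hn.sublist ?_)
  simp

/-- A ditrail between vertices of `H` stays in `H` if `G` is sharp. -/
theorem isDiwalk_of_sharp (h : Contraction G u H T K g) (hG : G.IsSharpSemiradial α u)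
    (hG' : ¬ G.HasLoop u) (hK : K.IsDiwalk x a l y b) (hn : l.Nodup) (hx : x ∈ H.vertexSet)
    (hy : y ∈ H.vertexSet) : H.IsDiwalk x a l y b := by
  induction hK with
  | nil => exact .nil _ _ hx
  | cons x a e y b l z c hj hl ih =>
    by_cases he : e ∈ H.edgeSet
    · have := hj.of_isSubgraph h.isSubgraph he
      exact .cons _ _ _ _ _ _ _ _ this (ih hn.of_cons this.right_mem hy)
    · exfalso
      by_cases hyH : y ∈ H.vertexSet
      · obtain ⟨e, he', rfl⟩ := h.exists_edge hj.1 he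
        have hG := h.joins e he' _ _ _ _ hj
        rw [collapse_of_mem hx, collapse_of_mem hyH] at hG
        exact hG' ⟨_, _, _, hG⟩
      · obtain ⟨e', l', l₁, l₂, t, d, rfl, ht, hj', hl', hn', -⟩ :=
          h.exists_excursion hj hx hyH hl hy hn
        -- The neighbor `y` of `u` reaches `u` with sign `-b` along the excursion and with sign `b`
        -- back over its first edge, so it is not linear.
        have h₁ : G.HasDitrailFrom y (-b) u := ⟨d, hl'.hasDitrail hn'.of_cons⟩
        have h₂ : G.HasDitrailFrom y b u := ⟨a, hj'.symm.hasDitrail⟩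
        have h₃ := (hG.2 y hl'.left_notMem ⟨_, _, _, hj'⟩).2
        rcases eq_or_eq_neg b α with rfl | rfl
        · exact h₃ h₁
        · exact h₃ h₂

theorem edge_mem_of_port (h : Contraction G u H (H.vertexSet \ {r}) K g) (hj : K.Joins e r a x b)
    (hr : r ∈ H.vertexSet) : H.Joins e r a x b := by
  by_cases he : e ∈ H.edgeSet
  · exact hj.of_isSubgraph h.isSubgraph he
  · obtain ⟨e, he', rfl⟩ := h.exists_edge hj.1 he
    exact absurd rfl (h.port e he' _ _ _ _ hj hr).2

/-- From outside, `H` is entered at a vertex other than `r`, where an almost strong radial offers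
both first signs. Closed ditrails at `r` stay in `H` by sharpness of `G`, and all edges at `r`
belong to `H`. -/
theorem isRoundRadial (h : Contraction G u H (H.vertexSet \ {r}) K g)
    (hG : G.IsSharpSemiradial α u) (hG' : ¬ G.HasLoop u) (hH : H.IsAlmostStrongRadial α r) :
    K.IsRoundRadial α r := by
  obtain ⟨⟨hr, hH₁⟩, hH₂, hH₃⟩ := hH
  refine ⟨⟨h.isSubgraph.1 hr, fun v hv => ?_⟩, ?_, ?_⟩
  · by_cases hvH : v ∈ H.vertexSet
    · exact (hH₁ v hvH).mono h.isSubgraph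
    · obtain ⟨hvG, hvu⟩ := h.mem_of_notMem hv hvH
      obtain ⟨b, hb⟩ := hG.1.2 v hvG
      obtain ⟨l, hn, d, t, ht, hl⟩ := h.hasDitrail_lift hb hvu
      refine hl.append_hasDitrail h.isSubgraph hn ?_
      rcases eq_or_eq_neg (-d) α with hd | hd <;> rw [hd]
      · exact hH₁ t ht.1
      · exact hH₂ t ht.1 ht.2
  · rintro ⟨l, hl, hn⟩
    exact hH₃ ⟨l, h.isDiwalk_of_sharp hG hG' hl hn hr hr, hn⟩
  · intro e v b hv hj
    exact (hH₂ v (h.edge_mem_of_port hj hr).right_mem hv).mono h.isSubgraph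

/-- A ditrail that leaves a vertex of `H` other than `r` with `-α` can never reach `r`. An edge of
`H` takes it to another such vertex, arriving with `α`, so that it leaves with `-α` again. An edge
or excursion outside `H` that returns does so at a vertex other than `r`, and also with `α`, since
`G` has no closed `(-α, -α)`-ditrail at `u`. -/
theorem not_isDitrail_of_isLinearSemiradial (h : Contraction G u H (H.vertexSet \ {r}) K g)
    (hG : ¬ G.HasDitrail u (-α) u (-α)) (hH : H.IsLinearSemiradial α r) (hx : x ∈ H.vertexSet)
    (hxr : x ≠ r) : ¬ K.IsDitrail x (-α) l r b := by
  induction hn : l.length using Nat.strong_induction_on generalizing l x with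
  | _ n ih =>
    rintro ⟨hl, hnd⟩
    have hr : r ∈ H.vertexSet := hH.1.1
    rcases l with - | ⟨e, l⟩
    · exact hxr hl.eq_of_nil.1
    cases hl with
    | cons _ _ _ y b _ _ _ hj hl =>
      by_cases he : e ∈ H.edgeSet
      · have hjH := hj.of_isSubgraph h.isSubgraph he
        have hyr : y ≠ r := by
          rintro rfl
          exact ne_neg_self α (hH.eq_of_joins_root hjH hxr).symm
        rcases eq_or_eq_neg b α with rfl | rfl
        · exact ih _ (by simp [← hn]) hjH.right_mem hyr rfl ⟨hl, hnd.of_cons⟩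
        · exact hH.not_joins hxr hyr hjH
      · by_cases hyH : y ∈ H.vertexSet
        · obtain ⟨e, he', rfl⟩ := h.exists_edge hj.1 he
          have hjG := h.joins e he' _ _ _ _ hj
          have hyr := (h.port e he' _ _ _ _ hj.symm hyH).2
          rw [collapse_of_mem hx, collapse_of_mem hyH] at hjG
          rcases eq_or_eq_neg b α with rfl | rfl
          · exact ih _ (by simp [← hn]) hyH hyr rfl ⟨hl, hnd.of_cons⟩
          · exact hG hjG.hasDitrail
        · obtain ⟨e', l', l₁, l₂, t, d, rfl, ht, hj', hl', hn', hl₂⟩ :=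
            h.exists_excursion hj hx hyH hl hr hnd
          rcases eq_or_eq_neg d α with rfl | rfl
          · refine ih l₂.length ?_ ht.1 ht.2 rfl ⟨hl₂, ?_⟩
            · simp only [← hn, List.length_cons, List.length_append]; omega
            · exact (List.nodup_append.1 hnd.of_cons).2.1
          · exact hG ⟨_, .cons _ _ _ _ _ _ _ _ hj' hl'.isDiwalk, hn'⟩

theorem isSharpSemiradial_of_isRoundRadial (h : Contraction G u H (H.vertexSet \ {r}) K g)
    (hG : G.IsRoundRadial α u) (hH : H.IsLinearSemiradial α r) :
    K.IsSharpSemiradial α r ∧ ¬ K.HasLoop r := by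
  have hr : r ∈ H.vertexSet := hH.1.1
  have hK : K.IsSemiradial α r := by
    refine ⟨h.isSubgraph.1 hr, fun v hv => ?_⟩
    by_cases hvH : v ∈ H.vertexSet
    · exact (hH.1.2 v hvH).mono h.isSubgraph
    · obtain ⟨hvG, hvu⟩ := h.mem_of_notMem hv hvH
      -- The last sign `-α` survives truncation at `u`, so the continuation in `H` needs only the
      -- sign `α`.
      obtain ⟨l, hn, hl⟩ := (hG.1.2 v hvG).exists_reach hG.2.1 hvu
      obtain ⟨t, ht, hl'⟩ := h.reach_lift hl
      obtain ⟨c, hc⟩ := hH.1.2 t ht.1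
      exact ⟨c, hl'.append_hasDitrail h.isSubgraph (h.nodup_map hl.isDiwalk.edge_mem hn)
        (by rwa [neg_neg])⟩
  refine ⟨⟨hK, ?_⟩, ?_⟩
  · rintro v hv ⟨e, a, b, hj⟩
    refine ⟨hK.2 v hj.right_mem, ?_⟩
    rintro ⟨b, l, hl⟩
    exact h.not_isDitrail_of_isLinearSemiradial hG.2.1 hH (h.edge_mem_of_port hj hr).right_mem hv hl
  · rintro ⟨e, a, b, hj⟩
    exact hH.2.1 ⟨e, a, b, h.edge_mem_of_port hj hr⟩

end Contraction

/-- The walk meets `r` only at its end, with sign `-α`, whereas every added edge has an end at `r`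
with sign `α`. Thus added edges are irrelevant to round radials. -/
theorem Reach.of_isAddEdgesAt (h : G.IsAddEdgesAt α r G') (hl : G'.Reach {r} x a l r (-α)) :
    G.Reach {r} x a l r (-α) := by
  refine hl.of_edge_mem h.2.1 fun e he => ?_
  by_contra heG
  obtain ⟨v, b, hj⟩ := h.2.2 e ⟨hl.isDiwalk.edge_mem e he, heG⟩
  generalize hS : ({r} : Set V) = S at hl
  generalize hz : r = z at hl
  generalize hβ : -α = β at hl
  induction hl with
  | last x a e' y b' hx hy hj' =>
    subst hS hz hβ
    obtain rfl := List.mem_singleton.1 he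
    rcases hj.eq_or_eq hj' with ⟨rfl, -⟩ | ⟨-, h', -⟩
    · exact hx rfl
    · exact ne_neg_self _ h'
  | cons x a e' y b' l z c hx hj' hl ih =>
    rcases List.mem_cons.1 he with rfl | he
    · subst hS hz hβ
      rcases hj.eq_or_eq hj' with ⟨rfl, -⟩ | ⟨rfl, -⟩
      · exact hx rfl
      · exact hl.left_notMem rfl
    · exact ih he hz hβ

theorem IsAddEdgesAt.joins (h : G.IsAddEdgesAt α r G') (hj : G'.Joins e r (-α) v b) (hv : v ≠ r) :
    G.Joins e r (-α) v b := by
  -- The edge alone, traversed towards `r`, is a walk that avoids added edges.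
  have : G'.Reach {r} v b [e] r (-α) := .last _ _ _ _ _ hv rfl hj.symm
  exact hj.of_isSubgraph h.2.1 ((this.of_isAddEdgesAt h).isDiwalk.edge_mem e (by simp))

theorem IsAddEdgesAt.hasDitrail_closed (h : G.IsAddEdgesAt α r G')
    (hG' : G'.HasDitrail r (-α) r (-α)) : G.HasDitrail r (-α) r (-α) := by
  obtain ⟨l, hl⟩ := hG'
  rcases hl.exists_closed with ⟨e, he⟩ | ⟨e, l, y, b, hn, hj, hl⟩
  · by_cases heG : e ∈ G.edgeSet
    · exact (he.of_isSubgraph h.2.1 heG).hasDitrail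
    · obtain ⟨v, b, hj⟩ := h.2.2 e ⟨he.1, heG⟩
      rcases hj.eq_or_eq he with ⟨-, h, -⟩ | ⟨-, h, -⟩ <;> exact absurd h (ne_neg_self α)
  · exact ⟨e :: l, .cons _ _ _ _ _ _ _ _ (h.joins hj hl.left_notMem)
      (hl.of_isAddEdgesAt h).isDiwalk, hn⟩

theorem IsRoundRadial.addEdges (hG : G.IsRoundRadial α r) (h : G.IsAddEdgesAt α r G') :
    G'.IsRoundRadial α r := by
  obtain ⟨⟨hr, hG₁⟩, hG₂, hG₃⟩ := hG
  refine ⟨⟨h.1 ▸ hr, fun v hv => (hG₁ v (h.1 ▸ hv)).mono h.2.1⟩,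
    fun h' => hG₂ (h.hasDitrail_closed h'), fun e v b hv hj => ?_⟩
  exact (hG₃ e v b hv (h.joins hj hv)).mono h.2.1

theorem IsRoundRadial.of_addEdges (hG : G'.IsRoundRadial α r) (h : G.IsAddEdgesAt α r G') :
    G.IsRoundRadial α r := by
  obtain ⟨⟨hr, hG₁⟩, hG₂, hG₃⟩ := hG
  have key : ∀ {v a}, v ≠ r → G'.HasDitrail v a r (-α) → G.HasDitrail v a r (-α) := by
    intro v a hv h'
    obtain ⟨l, hn, hl⟩ := h'.exists_reach hG₂ hv
    exact (hl.of_isAddEdgesAt h).hasDitrail hn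
  refine ⟨⟨h.1 ▸ hr, fun v hv => ?_⟩, fun h' => hG₂ (h'.mono h.2.1), fun e v b hv hj => ?_⟩
  · by_cases hvr : v = r
    · subst hvr
      exact .nil hv α
    · exact key hvr (hG₁ v (h.1 ▸ hv))
  · exact key hv (hG₃ e v b hv (hj.mono h.2.1))

theorem IsAlmostStrongRadial.isRoundRadial (h : G.IsAlmostStrongRadial α r) :
    G.IsRoundRadial α r :=
  ⟨h.1, h.2.2, fun _ v _ hv hj => h.2.1 v hj.right_mem hv⟩

mutual

theorem RoundClass.isRoundRadial {G : BidirectedGraph V E} {r : V} :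
    RoundClass α G r → G.IsRoundRadial α r
  | .almostStrong _ _ hG => hG.isRoundRadial
  | .addEdges _ _ _ hG hG' => hG.isRoundRadial.addEdges hG'
  | .glue _ _ _ _ _ hG hH hK =>
    have ⟨_, h⟩ := hK.exists_contraction
    h.isRoundRadial hG.isSharpSemiradial.1 hG.isSharpSemiradial.2 hH

theorem SharpClass.isSharpSemiradial {G : BidirectedGraph V E} {r : V} :
    SharpClass α G r → G.IsSharpSemiradial α r ∧ ¬ G.HasLoop r
  | .linear _ _ hG => ⟨hG.isSharpSemiradial, hG.2.1⟩
  | .glue _ _ _ _ _ hG hH hK =>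
    have ⟨_, h⟩ := hK.exists_contraction
    h.isSharpSemiradial_of_isRoundRadial hG.isRoundRadial hH

end

end

-- Decomposition by contracting greatest sets

section
variable {V E : Type*} {G H K : BidirectedGraph V E} {S T X : Set V} {B : Set ℤˣ}
  {Q : Set V → V → Prop} {x y z r u v t w p : V} {a b c d α σ : ℤˣ} {e : E} {l l₁ l₂ : List E}
  {g : E → E}

/-- `X` is a set of vertices of `K` that contains `r` and whose other elements satisfy `Q X`. -/
def IsRootedSet (K : BidirectedGraph V E) (r : V) (Q : Set V → V → Prop) (X : Set V) : Prop :=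
  r ∈ X ∧ X ⊆ K.vertexSet ∧ ∀ x ∈ X, x ≠ r → Q X x

theorem isRootedSet_singleton (hr : r ∈ K.vertexSet) : K.IsRootedSet r Q {r} :=
  ⟨rfl, by simpa using hr, fun _ hx hx' => absurd hx hx'⟩

/-- As `Q` is monotone in the set, the union of all rooted sets is rooted. -/
theorem exists_isGreatest_isRootedSet (hr : r ∈ K.vertexSet)
    (hQ : ∀ X Y x, X ⊆ Y → Q X x → Q Y x) : ∃ S, IsGreatest {X | K.IsRootedSet r Q X} S := by
  refine ⟨⋃₀ {X | K.IsRootedSet r Q X}, ⟨?_, ?_, ?_⟩, fun X hX => Set.subset_sUnion_of_mem hX⟩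
  · exact ⟨{r}, isRootedSet_singleton hr, rfl⟩
  · exact Set.sUnion_subset fun X hX => hX.2.1
  · rintro x ⟨X, hX, hx⟩ hxr
    exact hQ _ _ _ (Set.subset_sUnion_of_mem hX) (hX.2.2 x hx hxr)

/-- In the subgraph of `K` induced by `X`, ditrails to `r` with a last sign in `B` start from `x`
with both signs. -/
def HasBothDitrails (K : BidirectedGraph V E) (B : Set ℤˣ) (r : V) (X : Set V) (x : V) : Prop :=
  ∀ σ, ∃ b ∈ B, (K.induce X).HasDitrail x σ r b

theorem HasBothDitrails.mono (h : K.HasBothDitrails B r S x) (hST : S ⊆ T) :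
    K.HasBothDitrails B r T x :=
  fun σ => (h σ).imp fun _ h => ⟨h.1, h.2.mono (induce_mono hST)⟩

/-- The vertices of a walk to `S` from a neighbor of `S` can be added to `S`. -/
theorem IsRootedSet.exists_ear (hS : K.IsRootedSet r (K.HasBothDitrails B r) S) (hv : v ∉ S)
    (hj : K.Joins e v b t c) (ht : t ∈ S) (hp : ∃ b' ∈ B, (K.induce S).HasDitrail t (-c) r b')
    {t' : V} (hl : K.Reach S v (-b) l t' d) (hn : l.Nodup)
    (hp' : ∃ b' ∈ B, (K.induce S).HasDitrail t' (-d) r b') :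
    ∃ X, K.IsRootedSet r (K.HasBothDitrails B r) X ∧ v ∈ X := by
  let X : Set V := S ∪ {p | ∃ e ∈ l, ∃ a q c, K.Joins e p a q c}
  have hSX : S ⊆ X := Set.subset_union_left
  have hvX : v ∈ X := by
    cases hl with
    | last _ _ _ _ _ _ _ h => exact .inr ⟨_, List.mem_singleton_self _, _, _, _, h⟩
    | cons _ _ _ _ _ _ _ _ _ h _ => exact .inr ⟨_, List.mem_cons_self, _, _, _, h⟩
  have hsub : (K.induce S).IsSubgraph (K.induce X) := induce_mono hSX
  have hle : ∀ e ∈ l, e ∈ (K.induce X).edgeSet := by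
    intro e he
    obtain ⟨x, a, y, c, h⟩ := exists_joins (hl.isDiwalk.edge_mem e he)
    exact (h.induce (S := X) (.inr ⟨e, he, _, _, _, h⟩) (.inr ⟨e, he, _, _, _, h.symm⟩)).1
  have hlX := hl.of_edge_mem induce_isSubgraph hle
  have hjX : (K.induce X).Joins e v b t c := hj.induce hvX (hSX ht)
  have hout : ∀ e ∈ l, e ∉ (K.induce S).edgeSet :=
    Reach.notMem_edgeSet hsub (by rwa [vertexSet_induce hS.2.1])
  refine ⟨X, ⟨hSX hS.1, ?_, ?_⟩, hvX⟩
  · rintro x (hx | ⟨e, -, a, q, c, h⟩)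
    · exact hS.2.1 hx
    · exact h.left_mem
  intro x hx hxr
  by_cases hxS : x ∈ S
  · exact (hS.2.2 x hxS hxr).mono hSX
  obtain ⟨e₁, he₁, a, q, c', hj₁⟩ := hx.resolve_left hxS
  have hsplit : ∃ l₁ l₂ σ', l = l₁ ++ l₂ ∧ (K.induce X).IsDiwalk v (-b) l₁ x σ' ∧
      (K.induce X).IsDiwalk x (-σ') l₂ t' d := by
    obtain ⟨l₁, l₂, p, s, q', s', rfl, hj', h₁, h₂⟩ := hlX.isDiwalk.split he₁
    rcases hj₁.eq_or_eq (hj'.mono induce_isSubgraph) with ⟨rfl, -⟩ | ⟨rfl, -⟩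
    · exact ⟨l₁, e₁ :: l₂, _, rfl, h₁, .cons _ _ _ _ _ _ _ _ (by rwa [neg_neg]) h₂⟩
    · exact ⟨l₁ ++ [e₁], l₂, s', by simp, h₁.append (by rw [neg_neg]; exact .single hj'), h₂⟩
  obtain ⟨l₁, l₂, σ', rfl, h₁, h₂⟩ := hsplit
  obtain ⟨hn₁, hn₂, -⟩ := List.nodup_append.1 hn
  intro σ
  rcases eq_or_eq_neg σ σ' with rfl | rfl
  -- With the sign `σ'`, go back along `l₁` to `v` and enter `S` over `e`. Since `x ∉ S`, the edges
  -- of `l₁` are not last in the walk and avoid `S`, so `e` is not repeated. With the sign `-σ'`, go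
  -- forward along `l₂`.
  · have hl₂ : l₂ ≠ [] := by
      rintro rfl
      exact hxS (h₂.eq_of_nil.1 ▸ hl.right_mem)
    have hel : e ∉ l₁ := fun he => hl.notMem_of_append hl₂ he hj.symm ht
    obtain ⟨b', hb', h'⟩ := hp
    refine ⟨b', hb', IsDitrail.append_hasDitrail (l := l₁.reverse ++ [e]) hsub
      ⟨h₁.reverse.append (by rw [neg_neg]; exact .single hjX), ?_⟩ ?_ h'⟩
    · simpa [List.nodup_append, hn₁] using fun a ha (h : a = e) => hel (h ▸ ha)
    · intro e' he'
      rcases List.mem_append.1 he' with he' | he'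
      · exact hout e' (List.mem_append_left _ (List.mem_reverse.1 he'))
      · obtain rfl := List.mem_singleton.1 he'
        exact fun he => hv (hj.of_isSubgraph induce_isSubgraph he).left_mem.2
  · obtain ⟨b', hb', h'⟩ := hp'
    exact ⟨b', hb', IsDitrail.append_hasDitrail hsub ⟨h₂, hn₂⟩
      (fun e he => hout e (List.mem_append_right _ he)) h'⟩

/-- Contracting the greatest set of vertices with ditrails to `r` for both signs leaves a sharp
semiradial. -/
theorem isSharpSemiradial_contract (hu : u ∉ K.vertexSet) (hK : K.IsSemiradial α r)
    (hS : IsGreatest {X | K.IsRootedSet r (K.HasBothDitrails B r) X} S)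
    (h : (K.contract S u).IsGluingSum u (K.induce S) T K)
    (hT : ∀ t ∈ T, K.HasBothDitrails B r S t) : (K.contract S u).IsSharpSemiradial α u := by
  obtain ⟨g, h⟩ := h.exists_contraction
  have hSK : (K.induce S).vertexSet = S := vertexSet_induce hS.1.2.1
  have hG : (K.contract S u).IsSemiradial α u := by
    refine ⟨h.mem, fun v hv => ?_⟩
    by_cases hvu : v = u
    · subst hvu
      exact ⟨_, .nil hv α⟩
    · obtain ⟨b, hb⟩ := hK.2 v (h.mem_of_ne hv hvu)
      obtain ⟨d, -, -, hd, -⟩ := h.hasDitrail_project hb (h.notMem hv)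
        (by rw [hSK]; exact hS.1.1)
      exact ⟨d, hd⟩
  refine ⟨hG, ?_⟩
  rintro v hv ⟨e, a, b, hj⟩
  refine ⟨hG.2 v hj.right_mem, fun hα => ?_⟩
  -- If `v` is not linear, it has a ditrail whose first sign is opposite to that over `e`; its lift
  -- closes an ear at `v`.
  have hb : (K.contract S u).HasDitrailFrom v (-b) u := by
    rcases eq_or_eq_neg (-b) α with hb | hb
    · exact hb ▸ hG.2 v hj.right_mem
    · exact hb ▸ hα
  obtain ⟨c, hc⟩ := hb
  obtain ⟨l, hn, d, t', ht', hl⟩ := h.hasDitrail_lift hc hv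
  obtain ⟨t, ht, hj', hvS⟩ := h.exists_joins_root hj.symm hv
  have hTS := h.subset
  rw [hSK] at hl hvS hTS
  obtain ⟨X, hX, hvX⟩ := hS.1.exists_ear hvS hj' (hTS ht) (hT t ht _) hl hn (hT t' ht' _)
  exact hvS (hS.2 hX hvX)

theorem ncard_contract_lt (hu : u ∉ K.vertexSet) (hS : S ⊆ K.vertexSet) (hx : x ∈ S) (hy : y ∈ S)
    (hxy : x ≠ y) : (K.contract S u).vertexSet.ncard < K.vertexSet.ncard := by
  have h₁ : 1 < S.ncard := (Set.one_lt_ncard (K.finite_vertexSet.subset hS)).2 ⟨x, hx, y, hy, hxy⟩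
  have h₂ := Set.ncard_sdiff_add_ncard_of_subset hS K.finite_vertexSet
  have h₃ : (K.contract S u).vertexSet.ncard = (K.vertexSet \ S).ncard + 1 :=
    Set.ncard_insert_of_notMem (fun h => hu h.1) K.finite_vertexSet.sdiff
  omega

/-- The graph obtained from `K` by deleting the edges over which `r` has the sign `α`. -/
def deleteEdgesAt (K : BidirectedGraph V E) (α : ℤˣ) (r : V) : BidirectedGraph V E where
  vertexSet := K.vertexSet
  edgeSet := {e ∈ K.edgeSet | ¬ ∃ v b, K.Joins e r α v b}
  ends := K.ends
  finite_vertexSet := K.finite_vertexSet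
  finite_edgeSet := K.finite_edgeSet.subset fun _ h => h.1
  mem_vertexSet e he := K.mem_vertexSet e he.1

theorem isAddEdgesAt_deleteEdgesAt : (K.deleteEdgesAt α r).IsAddEdgesAt α r K := by
  refine ⟨rfl, ⟨subset_rfl, fun _ h => h.1, fun _ _ => rfl⟩, fun e he => ?_⟩
  by_contra h
  exact he.2 ⟨he.1, h⟩

theorem IsRoundRadial.roundClass [Infinite V] (hK : K.IsRoundRadial α r)
    (h0 : ∀ e v b, ¬ K.Joins e r α v b)
    (ih : ∀ (G : BidirectedGraph V E) (u : V), G.vertexSet.ncard < K.vertexSet.ncard →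
      G.IsSharpSemiradial α u → ¬ G.HasLoop u → SharpClass α G u) : RoundClass α K r := by
  obtain ⟨⟨hr, hK₁⟩, hK₂, hK₃⟩ := hK
  obtain ⟨S, hS⟩ := exists_isGreatest_isRootedSet (Q := K.HasBothDitrails {-α} r) hr
    fun X Y x hXY h => h.mono hXY
  by_cases hSK : K.vertexSet ⊆ S
  · refine .almostStrong K r ⟨⟨hr, hK₁⟩, fun v hv hvr => ?_, hK₂⟩
    obtain ⟨b, rfl, hb⟩ := hS.1.2.2 v (hSK hv) hvr (-α)
    exact hb.mono induce_isSubgraph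
  have hadj : ∀ e v b, v ≠ r → K.Joins e r (-α) v b → v ∈ S := by
    intro e v b hv hj
    have hb : K.HasDitrail v (-b) r (-α) := by
      rcases eq_or_eq_neg (-b) α with hb | hb <;> rw [hb]
      · exact hK₁ v hj.right_mem
      · exact hK₃ e v b hv hj
    obtain ⟨l, hn, hl⟩ := hb.exists_reach hK₂ hv
    -- The edge `e` and the walk `l` form an ear over `{r}`; both arrive at `r` with `-α`, so the
    -- trivial ditrail at `r` completes them.
    have hp : ∃ b' ∈ ({-α} : Set ℤˣ), (K.induce {r}).HasDitrail r (- -α) r b' :=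
      ⟨-α, rfl, by rw [neg_neg]; exact .nil (G := K.induce {r}) ⟨hr, rfl⟩ α⟩
    obtain ⟨X, hX, hvX⟩ := (isRootedSet_singleton hr).exists_ear hv hj.symm rfl hp hl hn hp
    exact hS.2 hX hvX
  obtain ⟨u, hu⟩ := K.finite_vertexSet.exists_notMem
  -- No edge leaves `S` at `r`: by `h0` the sign of `r` is `-α`, and then `hadj` applies.
  have hG := isGluingSum_contract (T := S \ {r}) hu hS.1.2.1 Set.sdiff_subset (by
    rintro e x a y b hj hx hy
    refine ⟨hx, ?_⟩
    rintro rfl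
    rcases eq_or_eq_neg a α with rfl | rfl
    · exact h0 e y b hj
    · exact hy (hadj e y b (fun h => hy (h ▸ hx)) hj))
  obtain ⟨w, hw, hwS⟩ := Set.not_subset.1 hSK
  obtain ⟨l, -, hl⟩ := (hK₁ w hw).exists_reach hK₂ fun h => hwS (h ▸ hS.1.1)
  obtain ⟨e, v, c, hv, hj⟩ := hl.exists_last
  have hvS := hadj e v c hv hj.symm
  refine .glue (K.contract S u) (K.induce S) K u r (ih _ u ?_ ?_ ?_) ?_ ?_
  · exact ncard_contract_lt hu hS.1.2.1 hvS hS.1.1 hv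
  · exact isSharpSemiradial_contract hu ⟨hr, fun v hv => ⟨_, hK₁ v hv⟩⟩ hS hG
      fun t ht => hS.1.2.2 t ht.1 ht.2
  · exact not_hasLoop_contract hu
  · refine ⟨⟨⟨hr, hS.1.1⟩, fun x hx => ?_⟩, fun x hx hxr => ?_,
      fun h => hK₂ (h.mono induce_isSubgraph)⟩
    · by_cases hxr : x = r
      · subst hxr
        exact .nil hx α
      · obtain ⟨b, rfl, hb⟩ := hS.1.2.2 x hx.2 hxr α
        exact hb
    · obtain ⟨b, rfl, hb⟩ := hS.1.2.2 x hx.2 hxr (-α)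
      exact hb
  · rwa [vertexSet_induce hS.1.2.1]

theorem IsSharpSemiradial.sharpClass [Infinite V] (hK : K.IsSharpSemiradial α r)
    (hK' : ¬ K.HasLoop r)
    (ih : ∀ (G : BidirectedGraph V E) (u : V), G.vertexSet.ncard < K.vertexSet.ncard →
      G.IsRoundRadial α u → RoundClass α G u) : SharpClass α K r := by
  obtain ⟨⟨hr, hK₁⟩, hK₂⟩ := hK
  obtain ⟨S, hS⟩ := exists_isGreatest_isRootedSet
    (Q := fun X x => (K.induce X).HasDitrailFrom x α r ∧ ¬ K.HasDitrailFrom x (-α) r) hr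
    fun X Y x hXY h => ⟨h.1.mono (induce_mono hXY), h.2⟩
  have hclosed : ∀ l b, K.IsDitrail r (-α) l r b → l = [] := by
    rintro l b ⟨hl, hn⟩
    rcases l with - | ⟨e, l⟩
    · rfl
    exfalso
    cases hl with
    | cons _ _ _ y b' _ _ _ hj hl =>
      have hy : y ≠ r := by
        rintro rfl
        exact hK' ⟨_, _, _, hj⟩
      -- A nontrivial closed ditrail would give the neighbor `y` a `-α`-ditrail, either by its
      -- remainder or by its first edge reversed.
      have h₁ := (hK₂ y hy ⟨_, _, _, hj⟩).2
      rcases eq_or_eq_neg b' α with rfl | rfl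
      · exact h₁ ⟨b, l, hl, hn.of_cons⟩
      · exact h₁ ⟨_, hj.symm.hasDitrail⟩
  have hlin : ∀ H : BidirectedGraph V E, H.IsSubgraph K → H.IsSemiradial α r →
      (∀ x ∈ H.vertexSet, x ≠ r → ¬ K.HasDitrailFrom x (-α) r) → H.IsLinearSemiradial α r := by
    refine fun H hH hHα h => ⟨hHα, fun ⟨e, a, b, hj⟩ => hK' ⟨e, a, b, hj.mono hH⟩, ?_⟩
    intro x hx l b hl
    have hlK : K.IsDitrail x (-α) l r b := ⟨hl.1.mono hH, hl.2⟩
    by_cases hxr : x = r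
    · subst hxr
      exact hclosed l b hlK
    · exact absurd ⟨b, l, hlK⟩ (h x hx hxr)
  by_cases hall : ∀ x ∈ K.vertexSet, x ≠ r → ¬ K.HasDitrailFrom x (-α) r
  · exact .linear K r (hlin K ⟨subset_rfl, subset_rfl, fun _ _ => rfl⟩ ⟨hr, hK₁⟩ hall)
  have hadj : ∀ e a v b, v ≠ r → K.Joins e r a v b → v ∈ S := by
    intro e a v b hv hj
    have h₁ := (hK₂ v hv ⟨_, _, _, hj⟩).2
    have hX : K.IsRootedSet r
        (fun X x => (K.induce X).HasDitrailFrom x α r ∧ ¬ K.HasDitrailFrom x (-α) r) {r, v} := by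
      refine ⟨by simp, ?_, ?_⟩
      · rintro x (rfl | rfl)
        · exact hr
        · exact hj.right_mem
      · rintro x (rfl | rfl) hx
        · exact absurd rfl hx
        · rcases eq_or_eq_neg b α with rfl | rfl
          · exact ⟨⟨_, (hj.symm.induce (by simp) (by simp)).hasDitrail⟩, h₁⟩
          · exact absurd ⟨_, hj.symm.hasDitrail⟩ h₁
    exact hS.2 hX (by simp)
  push Not at hall
  obtain ⟨w, hw, hwr, -⟩ := hall
  obtain ⟨b, hb⟩ := hK₁ w hw
  obtain ⟨l, z, c, -, hl, -⟩ := hb.first_hit (S := {r}) hwr rfl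
  obtain ⟨e₀, v₀, c₀, hv₀, hj₀⟩ := hl.exists_last
  obtain rfl : z = r := hl.right_mem
  have hvS := hadj _ _ _ _ hv₀ hj₀.symm
  obtain ⟨u, hu⟩ := K.finite_vertexSet.exists_notMem
  have hG := isGluingSum_contract (T := S \ {z}) hu hS.1.2.1 Set.sdiff_subset (by
    rintro e x a y b hj hx hy
    refine ⟨hx, ?_⟩
    rintro rfl
    exact hy (hadj e _ y b (fun h => hy (h ▸ hx)) hj))
  obtain ⟨g, h⟩ := hG.exists_contraction
  have hSK : (K.induce S).vertexSet = S := vertexSet_induce hS.1.2.1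
  -- Entering `S` at `t` with `α` would leave a `-α`-ditrail from the linear vertex `t`.
  have hproj : ∀ {x a}, x ∈ K.vertexSet → x ∉ S → K.HasDitrailFrom x a z →
      (K.contract S u).HasDitrail x a u (-α) := by
    rintro x a hx hxS ⟨b, hb⟩
    obtain ⟨d, t, ht, hd, ht'⟩ := h.hasDitrail_project hb (by rwa [hSK]) (by rw [hSK]; exact hS.1.1)
    rcases eq_or_eq_neg d α with rfl | rfl
    · exact absurd ⟨b, ht'⟩ (hS.1.2.2 t ht.1 ht.2).2
    · exact hd
  refine .glue (K.contract S u) (K.induce S) K u z (ih _ u ?_ ⟨⟨h.mem, ?_⟩, ?_, ?_⟩) ?_ ?_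
  · exact ncard_contract_lt hu hS.1.2.1 hvS hS.1.1 hv₀
  · intro v hv
    by_cases hvu : v = u
    · subst hvu
      exact .nil hv α
    · have hvK := h.mem_of_ne hv hvu
      exact hproj hvK (hSK ▸ h.notMem hv) (hK₁ v hvK)
  · rintro ⟨l, hl⟩
    rcases hl.exists_closed with ⟨e, he⟩ | ⟨e, l, y, b, hn, hj, hl⟩
    · exact not_hasLoop_contract hu ⟨e, _, _, he⟩
    · obtain ⟨t, ht, hl'⟩ := h.reach_lift hl
      obtain ⟨t', ht', hj', -⟩ := h.exists_joins_root hj.symm hl.left_notMem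
      have hn' := h.nodup_map (by simpa using ⟨hj.1, hl.isDiwalk.edge_mem⟩) hn
      -- The lift leaves `t'` with `-α` and returns at `t` with `-α`; continuing inside `S`
      -- contradicts the linearity of `t'`.
      obtain ⟨c, hc⟩ := (hS.1.2.2 t ht.1 ht.2).1
      refine (hS.1.2.2 t' ht'.1 ht'.2).2 ⟨c, ?_⟩
      refine IsDitrail.append_hasDitrail (H := K.induce S) (l := (e :: l).map g)
        induce_isSubgraph ⟨.cons _ _ _ _ _ _ _ _ hj'.symm hl'.isDiwalk, hn'⟩ ?_
        (by rwa [neg_neg])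
      intro e' he'
      obtain ⟨e', he'', rfl⟩ := List.mem_map.1 he'
      refine (h.bijOn.mapsTo ?_).2
      rcases List.mem_cons.1 he'' with rfl | he''
      · exact hj.1
      · exact hl.isDiwalk.edge_mem _ he''
  · intro e v b hv hj
    rcases eq_or_eq_neg b α with rfl | rfl
    · obtain ⟨t, ht, hj', hvS⟩ := h.exists_joins_root hj.symm hv
      rw [hSK] at hvS
      -- Otherwise `v` has no `-α`-ditrail in `K` (here `α` is `b`), while the edge to `t` begins an
      -- `α`-ditrail inside `insert v S`, so `S` could be enlarged.
      by_contra hneg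
      have hvα : ¬ K.HasDitrailFrom v (-b) z := fun h' => hneg (hproj hj'.left_mem hvS h')
      have hX : K.IsRootedSet z (fun X x => (K.induce X).HasDitrailFrom x b z ∧
          ¬ K.HasDitrailFrom x (-b) z) (insert v S) := by
        have hsub := Set.subset_insert v S
        refine ⟨hsub hS.1.1, Set.insert_subset hj'.left_mem hS.1.2.1, ?_⟩
        rintro x (rfl | hx) hxz
        · obtain ⟨c, hc⟩ := (hS.1.2.2 t ht.1 ht.2).1
          have hjX := hj'.induce (Set.mem_insert x S) (hsub ht.1)
          refine ⟨⟨c, IsDitrail.append_hasDitrail (induce_mono hsub)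
            ⟨.single hjX, List.nodup_singleton _⟩ ?_ (by rwa [neg_neg])⟩, hvα⟩
          simp only [List.mem_singleton, forall_eq]
          exact (h.bijOn.mapsTo hj.1).2
        · have := hS.1.2.2 x hx hxz
          exact ⟨this.1.mono (induce_mono hsub), this.2⟩
      exact hvS (hS.2 hX (Set.mem_insert v S))
    · exact hj.symm.hasDitrail
  · refine hlin _ induce_isSubgraph ⟨⟨hr, hS.1.1⟩, fun v hv => ?_⟩ fun x hx hxr =>
      (hS.1.2.2 x hx.2 hxr).2
    by_cases hvr : v = z
    · subst hvr
      exact ⟨_, .nil hv α⟩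
    · exact (hS.1.2.2 v hv.2 hvr).1
  · rwa [hSK]

/-- Each class calls on the other for smaller graphs. Deleting the edges with sign `α` at `r` keeps
the vertex set, so that normalization costs nothing in the induction. -/
theorem sharpClass_and_roundClass [Infinite V] (α : ℤˣ) (n : ℕ) :
    ∀ (K : BidirectedGraph V E) (r : V), K.vertexSet.ncard = n →
      (K.IsSharpSemiradial α r → ¬ K.HasLoop r → SharpClass α K r) ∧
        (K.IsRoundRadial α r → RoundClass α K r) := by
  induction n using Nat.strong_induction_on with
  | _ n ih =>
    rintro K r rfl
    refine ⟨fun h h' => h.sharpClass h' fun G u hG => (ih _ hG G u rfl).2, fun h => ?_⟩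
    refine .addEdges (K.deleteEdgesAt α r) K r ?_ isAddEdgesAt_deleteEdgesAt
    refine (h.of_addEdges isAddEdgesAt_deleteEdgesAt).roundClass ?_
      fun G u hG => (ih _ hG G u rfl).1
    exact fun e v b hj => hj.1.2 ⟨v, b, hj.mono isAddEdgesAt_deleteEdgesAt.2.1⟩

theorem sharpClass_iff [Infinite V] :
    SharpClass α K r ↔ K.IsSharpSemiradial α r ∧ ¬ K.HasLoop r :=
  ⟨fun h => h.isSharpSemiradial, fun h => (sharpClass_and_roundClass α _ K r rfl).1 h.1 h.2⟩

-- Semiradials and their absolute ground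

theorem IsSemiradial.exists_isGluingSum [Infinite V] (hK : K.IsSemiradial α r) :
    ∃ (G : BidirectedGraph V E) (u : V) (H : BidirectedGraph V E),
      SharpClass α G u ∧ H.IsAbsoluteSemiradial r ∧ G.IsGluingSum u H H.vertexSet K := by
  obtain ⟨S, hS⟩ := exists_isGreatest_isRootedSet (Q := K.HasBothDitrails Set.univ r) hK.1
    fun X Y x hXY h => h.mono hXY
  obtain ⟨u, hu⟩ := K.finite_vertexSet.exists_notMem
  have hboth : ∀ t ∈ S, K.HasBothDitrails Set.univ r S t := by
    intro t ht
    by_cases htr : t = r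
    · subst htr
      exact fun σ => ⟨-σ, trivial, .nil (G := K.induce S) ⟨hK.1, ht⟩ σ⟩
    · exact hS.1.2.2 t ht htr
  have hG := isGluingSum_contract (T := S) hu hS.1.2.1 subset_rfl fun e x a y b _ hx _ => hx
  refine ⟨K.contract S u, u, K.induce S, sharpClass_iff.2 ⟨?_, not_hasLoop_contract hu⟩, ?_, ?_⟩
  · exact isSharpSemiradial_contract hu hK hS hG hboth
  · refine fun σ => ⟨⟨hK.1, hS.1.1⟩, fun v hv => ?_⟩
    obtain ⟨b, -, hb⟩ := hboth v hv.2 σ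
    exact ⟨b, hb⟩
  · rwa [vertexSet_induce hS.1.2.1]

/-- If an absolute semiradial subgraph left `H`, one of its ditrails would enter `H` from a neighbor
of `u` in `G`. The `-α`-ditrail of this neighbor projects to `G`, against sharpness. An edge outside
`H` with both ends in `H` would be a loop over `u`. -/
theorem Contraction.isAbsoluteGround (h : Contraction G u H T K g) (hG : G.IsSharpSemiradial α u)
    (hG' : ¬ G.HasLoop u) (hH : H.IsAbsoluteSemiradial r) : K.IsAbsoluteGround r H := by
  refine ⟨h.isSubgraph, hH, fun H' hH' hr => ?_⟩
  have hsub : H'.vertexSet ⊆ H.vertexSet := by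
    intro w hw
    by_contra hwH
    obtain ⟨b, hb⟩ := (hr 1).2 w hw
    obtain ⟨l, z, c, -, hl, -⟩ := hb.first_hit hwH (hH 1).1
    obtain ⟨e, v, c, hv, hj⟩ := hl.exists_last
    have hjK := hj.mono hH'
    have he : e ∉ H.edgeSet := fun he => hv (hjK.of_isSubgraph h.isSubgraph he).left_mem
    obtain ⟨e, he', rfl⟩ := h.exists_edge hjK.1 he
    have hjG := h.joins e he' _ _ _ _ hjK
    rw [collapse_of_notMem hv, collapse_of_mem hl.right_mem] at hjG
    refine (hG.2 v (h.mem_of_notMem hjK.left_mem hv).2 ⟨_, _, _, hjG.symm⟩).2 ?_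
    obtain ⟨b, hb⟩ := (hr (-α)).2 v hj.left_mem
    obtain ⟨d, -, -, hd, -⟩ := h.hasDitrail_project (hb.mono hH') hv (hH 1).1
    exact ⟨d, hd⟩
  have hedge : H'.edgeSet ⊆ H.edgeSet := by
    intro e he
    by_contra heH
    obtain ⟨x, a, y, b, hj⟩ := BidirectedGraph.exists_joins he
    have hjK := hj.mono hH'
    obtain ⟨e, he', rfl⟩ := h.exists_edge hjK.1 heH
    have hjG := h.joins e he' _ _ _ _ hjK
    rw [collapse_of_mem (hsub hj.left_mem), collapse_of_mem (hsub hj.right_mem)] at hjG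
    exact hG' ⟨_, _, _, hjG⟩
  exact ⟨hsub, hedge, fun e he => (h.isSubgraph.2.2 e (hedge he)).symm.trans (hH'.2.2 e he)⟩

end

end BidirectedGraph


theorem mainTheorem2 {V E : Type*} [Infinite V] (α : ℤˣ) :
    (∀ (K : BidirectedGraph V E) (r : V),
      K.IsSemiradial α r ↔
        ∃ (G : BidirectedGraph V E) (u : V) (H : BidirectedGraph V E),
          BidirectedGraph.SharpClass α G u ∧ H.IsAbsoluteSemiradial r ∧
            G.IsGluingSum u H H.vertexSet K) ∧
    (∀ (G : BidirectedGraph V E) (u : V) (H K : BidirectedGraph V E) (r : V),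
      BidirectedGraph.SharpClass α G u → H.IsAbsoluteSemiradial r →
        G.IsGluingSum u H H.vertexSet K → K.IsAbsoluteGround r H) ∧
    (∀ (G : BidirectedGraph V E) (u : V),
      BidirectedGraph.SharpClass α G u ↔ G.IsSharpSemiradial α u ∧ ¬ G.HasLoop u) := by
  refine ⟨fun K r => ⟨fun h => h.exists_isGluingSum, ?_⟩, ?_, fun G u => BidirectedGraph.sharpClass_iff⟩
  · rintro ⟨G, u, H, hG, hH, hK⟩
    obtain ⟨g, h⟩ := hK.exists_contraction
    exact h.isSemiradial hG.isSharpSemiradial.1.1 (hH α).1 (hH α).2 fun t ht σ => (hH σ).2 t ht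
  · intro G u H K r hG hH hK
    obtain ⟨g, h⟩ := hK.exists_contraction
    exact h.isAbsoluteGround hG.isSharpSemiradial.1 hG.isSharpSemiradial.2 hH
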